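/- **Setting.** Let $n\in\{2,3\}$ and let $\Omega\subset\mathbb R^n$ be a bounded domain with polygonal/polyhedral boundary $\Gamma$ (that is, $\Omega$ is open and connected, $\Omega=\operatorname{int}\overline\Omega$, and $\overline\Omega$ is the union of a finite simplicial complex). Let $\Gamma_D,\Gamma_N\subseteq\Gamma$ be disjoint, $\Gamma=\overline{\Gamma_D}\cup\overline{\Gamma_N}$, $|\Gamma_D|>0$, $|\overline{\Gamma_D}\setminus\Gamma_D|=0$. Let $\gamma>0$; let $\nu:\mathbb R^2\to\mathbb R$ satisfy $0<\nu_1\le\nu\le\nu_2$ and $|\nu(a)-\nu(b)|\le L_\nu|a-b|$, $L_\nu>0$; let $\mathbb K=\operatorname{diag}(k_1,k_2)\in L^\infty(\Omega)$ with $k_i\ge k_0>0$ a.e.; let $\boldsymbol\alpha\in\mathbb R^2$, $\mathbf g\in\mathbb R^n$. Let $\kappa_1,\kappa_2,\kappa_3$ be such that $0<\kappa_1<2\delta_3(2\nu_1-\kappa_3\nu_2/\delta_1)$, $0<\kappa_2<2\delta_2$, $0<\kappa_3<2\nu_1\delta_1/\nu_2$ for some $\delta_1\in(0,1/\nu_2)$,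 $\delta_2\in(0,2/\gamma)$, $\delta_3\in(0,1)$. Put $\mathbb H=\mathbb L^2_{\rm tr}(\Omega)\times\mathbb H_0(\mathbf{div};\Omega)\times\mathbf H^1_0(\Omega)$, where $\mathbb L^2_{\rm tr}$ consists of the symmetric trace-free $L^2$ tensor fields and $\mathbb H_0(\mathbf{div})$ of the $L^2$ tensor fields $\boldsymbol\tau$ with row-wise divergence $\mathbf{div}\,\boldsymbol\tau\in L^2$ and $\int_\Omega\operatorname{tr}\boldsymbol\tau=0$, with norm $\|(\mathbf r,\boldsymbol\tau,\mathbf v)\|_{\mathbb H}^2=\|\mathbf r\|_0^2+\|\boldsymbol\tau\|_0^2+\|\mathbf{div}\,\boldsymbol\tau\|_0^2+\|\mathbf v\|_1^2$. With $\boldsymbol\tau^{\rm d}$ the deviatoric part and $\mathbf e(\mathbf u),\boldsymbol\omega(\mathbf u)$ the symmetric and skew parts of $\nabla\mathbf u$, set for $\vec x=(\mathbf t,\boldsymbol\sigma,\mathbf u)$, $\vec y=(\mathbf r,\boldsymbol\tau,\mathbf v)\in\mathbb H$ (all integrals over $\Omega$) $$\begin{aligned}A_\phi(\vec x,\vec y)={}&2\!\int\!\nu(\phi)\mathbf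 t:(\mathbf r-\kappa_3\boldsymbol\tau^{\rm d})+\!\int\!\mathbf t:(\boldsymbol\tau^{\rm d}-\kappa_1\mathbf e(\mathbf v))-\!\int\!\boldsymbol\sigma^{\rm d}:(\mathbf r-\kappa_3\boldsymbol\tau^{\rm d})+(1-\kappa_2\gamma)\!\int\!\mathbf u\cdot\mathbf{div}\,\boldsymbol\tau-\!\int\!\mathbf v\cdot\mathbf{div}\,\boldsymbol\sigma\\&+\!\int\!\boldsymbol\omega(\mathbf u):\boldsymbol\tau-\!\int\!\boldsymbol\sigma:\boldsymbol\omega(\mathbf v)+\gamma\!\int\!\mathbf u\cdot\mathbf v+\kappa_2\!\int\!\mathbf{div}\,\boldsymbol\sigma\cdot\mathbf{div}\,\boldsymbol\tau+\kappa_1\!\int\!\mathbf e(\mathbf u):\mathbf e(\mathbf v),\end{aligned}$$ $$B_{\mathbf w}(\vec x,\vec y)=\!\int(\mathbf u\otimes\mathbf w)^{\rm d}:(\kappa_3\boldsymbol\tau^{\rm d}-\mathbf r),\quad F_\phi(\vec y)=\!\int(\boldsymbol\alpha\cdot\phi)\,\mathbf g\cdot(\mathbf v-\kappa_2\mathbf{div}\,\boldsymbol\tau),\quad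 C(\chi,\psi)=\!\int\mathbb K\nabla\chi:\nabla\psi,\quad G_{\mathbf w,\phi}(\psi)=-\!\int(\nabla\phi)\mathbf w\cdot\psi,$$ where $\phi,\chi,\psi$ are $\mathbb R^2$-valued $H^1$ fields (temperature and concentration). **Continuous problem.** Given $\varphi_D\in\mathbf H^{1/2}(\Gamma_D)$ (the space of traces on $\Gamma_D$ of fields in $H^1(\Omega;\mathbb R^2)$), a solution is a pair $(\vec x,\varphi)$, $\vec x=(\mathbf t,\boldsymbol\sigma,\mathbf u)\in\mathbb H$, $\varphi\in H^1(\Omega;\mathbb R^2)$, $\varphi|_{\Gamma_D}=\varphi_D$, with $A_\varphi(\vec x,\vec y)+B_{\mathbf u}(\vec x,\vec y)=F_\varphi(\vec y)$ for all $\vec y\in\mathbb H$ and $C(\varphi,\psi)=G_{\mathbf u,\varphi}(\psi)$ for all $\psi\in H^1(\Omega;\mathbb R^2)$ with $\psi|_{\Gamma_D}=0$. **Galerkin scheme.** Let $k\ge0$, and let $\mathcal T_h$ be a conforming triangulation of $\overline\Omega$ by simplices such that $\overline{\Gamma_D}$ is a union of facets. Let $\mathbb H_h\subset\mathbb H$ be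 the set of $(\mathbf r_h,\boldsymbol\tau_h,\mathbf v_h)$ such that $\mathbf r_h$ is piecewise polynomial of degree $\le k$, the rows of $\boldsymbol\tau_h$ are piecewise in the Raviart–Thomas space $\mathbf P_k\oplus P_k\mathbf x$, and $\mathbf v_h$ is continuous, piecewise polynomial of degree $\le k+1$ and zero on $\Gamma$. Let $\mathbf H_h^\varphi\subset H^1(\Omega;\mathbb R^2)$ be the continuous piecewise polynomials of degree $\le k+1$, and let $\mathcal I_h^{SZ}:H^1(\Omega;\mathbb R^2)\to\mathbf H_h^\varphi$ be a Scott–Zhang interpolant: its value at a Lagrange node $a$ is $\int_{\sigma_a}\theta_a v$, where $\sigma_a$ is the element with $a$ in its interior, if there is one, and otherwise a facet containing $a$, contained in $\Gamma$ if $a\in\Gamma$ and in $\overline{\Gamma_D}$ if $a\in\overline{\Gamma_D}$, and $\theta_a\in P_{k+1}(\sigma_a)$ is determined by $\int_{\sigma_a}\theta_a p=p(a)$ for all $p\in P_{k+1}(\sigma_a)$. Let $E(\varphi_D)$ be the extension of $\varphi_D$ to $H^1(\Omega;\mathbb R^2)$ of minimal $H^1$ norm. A discrete solution is a pair $(\vec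 x_h,\varphi_h)\in\mathbb H_h\times\mathbf H_h^\varphi$ with $\varphi_h|_{\Gamma_D}=\mathcal I_h^{SZ}(E(\varphi_D))|_{\Gamma_D}$, $A_{\varphi_h}(\vec x_h,\vec y_h)+B_{\mathbf u_h}(\vec x_h,\vec y_h)=F_{\varphi_h}(\vec y_h)$ for all $\vec y_h\in\mathbb H_h$, and $C(\varphi_h,\psi_h)=G_{\mathbf u_h,\varphi_h}(\psi_h)$ for all $\psi_h\in\mathbf H_h^\varphi$ with $\psi_h|_{\Gamma_D}=0$. **Constants.** Let $c_1=\|i\|^2$ for the injection $i:\mathbf H^1(\Omega)\to\mathbf L^4(\Omega)$; $c_{gp}$ the least constant with $\|\psi\|_1\le c_{gp}|\psi|_1$ whenever $\psi|_{\Gamma_D}=0$; $\tilde\alpha=k_0c_{gp}^{-2}$; $\alpha(\Omega)$ the largest constant with $A_\phi(\vec x,\vec x)\ge\alpha(\Omega)\|\vec x\|_{\mathbb H}^2$ for all $\phi,\vec x$; $r_0=\alpha(\Omega)/(2c_1(2+\kappa_3^2)^{1/2})$; $C_{\mathbf A}=2\sqrt2(2+\kappa_2^2)^{1/2}/\alpha(\Omega)$.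 Let $\varepsilon\in(0,1)$, with $\varepsilon\ge\frac12$ if $n=3$, and let $C_\varepsilon,\tilde C_\varepsilon$ be the norms of the injections $H^\varepsilon(\Omega)\to L^{2n/(n-2\varepsilon)}(\Omega)$ (tensor fields, Sobolev–Slobodeckij norm) and $H^1(\Omega;\mathbb R^2)\to L^{n/\varepsilon}(\Omega;\mathbb R^2)$. For $r>0$ put $$M_r=3\max\{2,\gamma+\kappa_1,\kappa_2+\kappa_3,2\nu_2,1+2\nu_2\kappa_3,1+|1-\gamma\kappa_2|\}+c_1(2+\kappa_3^2)^{1/2}r,$$ $$C_{ST}=\tfrac{2}{\alpha(\Omega)}\max\{1,M_r\}\max\{\sqrt2(2+\kappa_2^2)^{1/2},\,2L_\nu C_\varepsilon\tilde C_\varepsilon(2+\kappa_3^2)^{1/2},\,c_1(2+\kappa_3^2)^{1/2},\,1+2M_r\}.$$ **Regularity assumption.** Let $r\in(0,r_0)$ and let $\hat C(r)>0$ be such that for all $(\mathbf w,\phi)\in\mathbf H^1_0(\Omega)\times H^1(\Omega;\mathbb R^2)$ with $\|\mathbf w\|_1+\|\phi\|_1\le r$, every $\vec x=(\mathbf t,\boldsymbol\sigma,\mathbf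 u)\in\mathbb H$ with $A_\phi(\vec x,\cdot)+B_{\mathbf w}(\vec x,\cdot)=F_\phi$ satisfies $\|\mathbf t\|_{\varepsilon}\le\hat C(r)|\boldsymbol\alpha||\mathbf g|\|\phi\|_0$. Put $C_1=C_{ST}(1+r\hat C(r)+rC_{\mathbf A})$. **Theorem.** Assume that $$r\,\frac{c_1}{\tilde\alpha}\le\frac12\qquad\text{and}\qquad C_1|\boldsymbol\alpha||\mathbf g|\le\frac12 .$$ Then there is a constant $C^*>0$, independent of the triangulation (in particular of $h$), such that for every solution $(\vec x,\varphi)$ of the continuous problem with $\|\mathbf u\|_1+\|\varphi\|_1\le r$, every triangulation $\mathcal T_h$ and Scott–Zhang interpolant $\mathcal I_h^{SZ}$ as above, and every solution $(\vec x_h,\varphi_h)$ of the Galerkin scheme with $\|\mathbf u_h\|_1+\|\varphi_h\|_1\le r$, $$\|\vec x-\vec x_h\|_{\mathbb H}+\|\varphi-\varphi_h\|_{1}\le C^*\Big\{\inf_{\vec y_h\in\mathbb H_h}\|\vec x-\vec y_h\|_{\mathbb H}+\|\varphi-\mathcal I_h^{SZ}\varphi\|_1\Big\}.$$ -/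

import Mathlib

open MeasureTheory Filter Topology
open scoped ENNReal ContDiff

namespace DoubleDiffusion

noncomputable section

/-! ### Vectors and tensors -/

/-- Points of `ℝⁿ` and `m`-vectors, with the Euclidean norm. -/
abbrev Vec (m : ℕ) := EuclideanSpace ℝ (Fin m)

/-- `m × n` tensors; norm and inner product are those of Frobenius, `τ : ζ = ∑ τᵢⱼ ζᵢⱼ`. -/
abbrev Tens (m n : ℕ) := EuclideanSpace ℝ (Fin m × Fin n)

/-- The trace `tr τ`. -/
def tr {n : ℕ} (τ : Tens n n) : ℝ := ∑ i, τ (i, i)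

/-- The deviatoric part `τᵈ = τ - (1/n) tr(τ) I`. -/
def dev {n : ℕ} (τ : Tens n n) : Tens n n :=
  WithLp.toLp 2 fun p => τ p - if p.1 = p.2 then tr τ / n else 0

/-- The symmetric part; `e(u) = symPart (∇u)`. -/
def symPart {n : ℕ} (τ : Tens n n) : Tens n n :=
  WithLp.toLp 2 fun p => (τ p + τ (p.2, p.1)) / 2

/-- The skew-symmetric part; `ω(u) = skewPart (∇u)`. -/
def skewPart {n : ℕ} (τ : Tens n n) : Tens n n :=
  WithLp.toLp 2 fun p => (τ p - τ (p.2, p.1)) / 2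

/-- The dyadic product `u ⊗ w`. -/
def outer {n : ℕ} (u w : Vec n) : Tens n n := WithLp.toLp 2 fun p => u p.1 * w p.2

/-- The product of a tensor and a vector. -/
def tensMul {m n : ℕ} (G : Tens m n) (w : Vec n) : Vec m :=
  WithLp.toLp 2 fun i => ∑ j, G (i, j) * w j

/-! ### Function spaces -/

/-- Lebesgue measure on `Ω`. -/
abbrev vol {n : ℕ} (Ω : Set (Vec n)) : Measure (Vec n) := volume.restrict Ω

/-- Surface measure in `ℝⁿ` (a constant multiple of it, which is immaterial below). -/
abbrev surf (n : ℕ) : Measure (Vec n) := Measure.hausdorffMeasure ((n : ℝ) - 1)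

/-- `η ∈ C_c^∞(Ω)`. -/
structure IsTest {n : ℕ} (Ω : Set (Vec n)) (η : Vec n → ℝ) : Prop where
  smooth : ContDiff ℝ ∞ η
  compact : HasCompactSupport η
  supp : tsupport η ⊆ Ω

/-- The classical partial derivative `∂η/∂xⱼ`. -/
def pderiv {n : ℕ} (j : Fin n) (η : Vec n → ℝ) (x : Vec n) : ℝ :=
  fderiv ℝ η x (EuclideanSpace.single j 1)

theorem IsTest.continuous_pderiv {n : ℕ} {Ω : Set (Vec n)} {η : Vec n → ℝ} (h : IsTest Ω η)
    (j : Fin n) : Continuous (pderiv j η) :=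
  (h.smooth.continuous_fderiv (by simp)).clm_apply continuous_const

theorem IsTest.compact_pderiv {n : ℕ} {Ω : Set (Vec n)} {η : Vec n → ℝ} (h : IsTest Ω η)
    (j : Fin n) : HasCompactSupport (pderiv j η) :=
  h.compact.fderiv_apply (𝕜 := ℝ) _

theorem integrable_coord_mul {n : ℕ} {ι : Type*} [Fintype ι] {Ω : Set (Vec n)}
    (f : Lp (EuclideanSpace ℝ ι) 2 (vol Ω)) (i : ι) {g : Vec n → ℝ} (hg : Continuous g)
    (hc : HasCompactSupport g) : Integrable (fun x => f x i * g x) (vol Ω) := by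
  have h1 : MemLp (fun x => f x i) 2 (vol Ω) :=
    (EuclideanSpace.proj (𝕜 := ℝ) i).comp_memLp' (Lp.memLp f)
  have h2 : MemLp g 2 (vol Ω) := hg.memLp_of_hasCompactSupport hc
  exact h1.integrable_mul h2

/-- `L²_tr(Ω)`: square integrable, symmetric, trace-free tensor fields. -/
def L2tr {n : ℕ} (Ω : Set (Vec n)) : Submodule ℝ (Lp (Tens n n) 2 (vol Ω)) where
  carrier := {r | ∀ᵐ x ∂(vol Ω), (∀ i j, r x (i, j) = r x (j, i)) ∧ tr (r x) = 0}
  zero_mem' := by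
    filter_upwards [Lp.coeFn_zero (Tens n n) 2 (vol Ω)] with x hx
    rw [hx]; simp [tr]
  add_mem' := by
    intro a b ha hb
    filter_upwards [ha, hb, Lp.coeFn_add a b] with x h1 h2 h3
    simp only [h3, tr, Pi.add_apply, PiLp.add_apply, Finset.sum_add_distrib] at *
    exact ⟨fun i j => by rw [h1.1, h2.1], by rw [h1.2, h2.2, add_zero]⟩
  smul_mem' := by
    intro c a ha
    filter_upwards [ha, Lp.coeFn_smul c a] with x h1 h3
    simp only [h3, tr, Pi.smul_apply, PiLp.smul_apply, smul_eq_mul, ← Finset.mul_sum] at *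
    exact ⟨fun i j => by rw [h1.1], by rw [h1.2, mul_zero]⟩

/-- `H¹(Ω)` for `m`-vector fields: pairs of a field in `L²` and its weak gradient
`(∂vᵢ/∂xⱼ)ᵢⱼ` in `L²`, normed by `(‖v‖₀² + ‖∇v‖₀²)^{1/2}`. -/
def H1 {n : ℕ} (Ω : Set (Vec n)) (m : ℕ) :
    Submodule ℝ (WithLp 2 (Lp (Vec m) 2 (vol Ω) × Lp (Tens m n) 2 (vol Ω))) where
  carrier := {v | ∀ η, IsTest Ω η → ∀ i j,
    ∫ x, v.fst x i * pderiv j η x ∂(vol Ω) = -∫ x, v.snd x (i, j) * η x ∂(vol Ω)}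
  zero_mem' := by
    intro η hη i j
    have h1 : ∀ᵐ x ∂(vol Ω), (0 : Lp (Vec m) 2 (vol Ω)) x i * pderiv j η x = 0 := by
      filter_upwards [Lp.coeFn_zero (Vec m) 2 (vol Ω)] with x hx
      rw [hx]; simp
    have h2 : ∀ᵐ x ∂(vol Ω), (0 : Lp (Tens m n) 2 (vol Ω)) x (i, j) * η x = 0 := by
      filter_upwards [Lp.coeFn_zero (Tens m n) 2 (vol Ω)] with x hx
      rw [hx]; simp
    simp only [WithLp.zero_fst, WithLp.zero_snd]
    rw [integral_congr_ae h1, integral_congr_ae h2]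
    simp
  add_mem' := by
    intro a b ha hb η hη i j
    have h1 : ∀ᵐ x ∂(vol Ω), (a.fst + b.fst) x i * pderiv j η x =
        a.fst x i * pderiv j η x + b.fst x i * pderiv j η x := by
      filter_upwards [Lp.coeFn_add a.fst b.fst] with x hx
      rw [hx]; simp [add_mul]
    have h2 : ∀ᵐ x ∂(vol Ω), (a.snd + b.snd) x (i, j) * η x =
        a.snd x (i, j) * η x + b.snd x (i, j) * η x := by
      filter_upwards [Lp.coeFn_add a.snd b.snd] with x hx
      rw [hx]; simp [add_mul]
    simp only [WithLp.add_fst, WithLp.add_snd]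
    rw [integral_congr_ae h1, integral_congr_ae h2,
      integral_add (integrable_coord_mul _ _ (hη.continuous_pderiv j) (hη.compact_pderiv j))
        (integrable_coord_mul _ _ (hη.continuous_pderiv j) (hη.compact_pderiv j)),
      integral_add (integrable_coord_mul _ _ hη.smooth.continuous hη.compact)
        (integrable_coord_mul _ _ hη.smooth.continuous hη.compact), ha η hη, hb η hη]
    ring
  smul_mem' := by
    intro c a ha η hη i j
    have h1 : ∀ᵐ x ∂(vol Ω), (c • a.fst) x i * pderiv j η x =
        c * (a.fst x i * pderiv j η x) := by
      filter_upwards [Lp.coeFn_smul c a.fst] with x hx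
      rw [hx]; simp [mul_assoc]
    have h2 : ∀ᵐ x ∂(vol Ω), (c • a.snd) x (i, j) * η x = c * (a.snd x (i, j) * η x) := by
      filter_upwards [Lp.coeFn_smul c a.snd] with x hx
      rw [hx]; simp [mul_assoc]
    simp only [WithLp.smul_fst, WithLp.smul_snd]
    rw [integral_congr_ae h1, integral_congr_ae h2, integral_const_mul, integral_const_mul,
      ha η hη]
    ring

/-- The field of an element of `H¹`. -/
def fld {n m : ℕ} {Ω : Set (Vec n)} (v : H1 Ω m) : Lp (Vec m) 2 (vol Ω) :=
  (v : WithLp 2 (Lp (Vec m) 2 (vol Ω) × Lp (Tens m n) 2 (vol Ω))).fst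

/-- The weak gradient of an element of `H¹`; its norm is the seminorm `|v|₁`. -/
def grd {n m : ℕ} {Ω : Set (Vec n)} (v : H1 Ω m) : Lp (Tens m n) 2 (vol Ω) :=
  (v : WithLp 2 (Lp (Vec m) 2 (vol Ω) × Lp (Tens m n) 2 (vol Ω))).snd

/-- `H₀(div; Ω)`: pairs of a tensor field in `L²` and its row-wise weak divergence in `L²`, the
trace having zero mean, normed by `(‖τ‖₀² + ‖div τ‖₀²)^{1/2}`. -/
def Hdiv0 {n : ℕ} (Ω : Set (Vec n)) :
    Submodule ℝ (WithLp 2 (Lp (Tens n n) 2 (vol Ω) × Lp (Vec n) 2 (vol Ω))) where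
  carrier := {τ | (∀ η, IsTest Ω η → ∀ i,
      ∑ j, ∫ x, τ.fst x (i, j) * pderiv j η x ∂(vol Ω) = -∫ x, τ.snd x i * η x ∂(vol Ω)) ∧
    Integrable (fun x => tr (τ.fst x)) (vol Ω) ∧ ∫ x, tr (τ.fst x) ∂(vol Ω) = 0}
  zero_mem' := by
    refine ⟨?_, ?_⟩
    · intro η hη i
      have h1 : ∀ j, ∀ᵐ x ∂(vol Ω),
          (0 : Lp (Tens n n) 2 (vol Ω)) x (i, j) * pderiv j η x = 0 := by
        intro j
        filter_upwards [Lp.coeFn_zero (Tens n n) 2 (vol Ω)] with x hx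
        rw [hx]; simp
      have h2 : ∀ᵐ x ∂(vol Ω), (0 : Lp (Vec n) 2 (vol Ω)) x i * η x = 0 := by
        filter_upwards [Lp.coeFn_zero (Vec n) 2 (vol Ω)] with x hx
        rw [hx]; simp
      simp only [WithLp.zero_fst, WithLp.zero_snd]
      rw [Finset.sum_congr rfl fun j _ => integral_congr_ae (h1 j), integral_congr_ae h2]
      simp
    · have h : (fun x => tr ((0 : Lp (Tens n n) 2 (vol Ω)) x)) =ᵐ[vol Ω] fun _ => (0 : ℝ) := by
        filter_upwards [Lp.coeFn_zero (Tens n n) 2 (vol Ω)] with x hx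
        rw [hx]; simp [tr]
      simp only [WithLp.zero_fst]
      exact ⟨(integrable_congr h).2 (integrable_zero _ _ _), by rw [integral_congr_ae h]; simp⟩
  add_mem' := by
    intro a b ha hb
    refine ⟨?_, ?_⟩
    · intro η hη i
      have h1 : ∀ j, ∀ᵐ x ∂(vol Ω), (a.fst + b.fst) x (i, j) * pderiv j η x =
          a.fst x (i, j) * pderiv j η x + b.fst x (i, j) * pderiv j η x := by
        intro j
        filter_upwards [Lp.coeFn_add a.fst b.fst] with x hx
        rw [hx]; simp [add_mul]
      have h2 : ∀ᵐ x ∂(vol Ω), (a.snd + b.snd) x i * η x =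
          a.snd x i * η x + b.snd x i * η x := by
        filter_upwards [Lp.coeFn_add a.snd b.snd] with x hx
        rw [hx]; simp [add_mul]
      simp only [WithLp.add_fst, WithLp.add_snd]
      rw [Finset.sum_congr rfl fun j _ => (integral_congr_ae (h1 j)).trans (integral_add
          (integrable_coord_mul _ _ (hη.continuous_pderiv j) (hη.compact_pderiv j))
          (integrable_coord_mul _ _ (hη.continuous_pderiv j) (hη.compact_pderiv j))),
        integral_congr_ae h2,
        integral_add (integrable_coord_mul _ _ hη.smooth.continuous hη.compact)
          (integrable_coord_mul _ _ hη.smooth.continuous hη.compact),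
        Finset.sum_add_distrib, ha.1 η hη, hb.1 η hη]
      ring
    · have h : (fun x => tr ((a.fst + b.fst) x)) =ᵐ[vol Ω]
          fun x => tr (a.fst x) + tr (b.fst x) := by
        filter_upwards [Lp.coeFn_add a.fst b.fst] with x hx
        rw [hx]; simp [tr, Finset.sum_add_distrib]
      simp only [WithLp.add_fst]
      refine ⟨(integrable_congr h).2 (ha.2.1.add hb.2.1), ?_⟩
      rw [integral_congr_ae h, integral_add ha.2.1 hb.2.1, ha.2.2, hb.2.2, add_zero]
  smul_mem' := by
    intro c a ha
    refine ⟨?_, ?_⟩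
    · intro η hη i
      have h1 : ∀ j, ∀ᵐ x ∂(vol Ω), (c • a.fst) x (i, j) * pderiv j η x =
          c * (a.fst x (i, j) * pderiv j η x) := by
        intro j
        filter_upwards [Lp.coeFn_smul c a.fst] with x hx
        rw [hx]; simp [mul_assoc]
      have h2 : ∀ᵐ x ∂(vol Ω), (c • a.snd) x i * η x = c * (a.snd x i * η x) := by
        filter_upwards [Lp.coeFn_smul c a.snd] with x hx
        rw [hx]; simp [mul_assoc]
      simp only [WithLp.smul_fst, WithLp.smul_snd]
      rw [Finset.sum_congr rfl fun j _ => (integral_congr_ae (h1 j)).trans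
          (integral_const_mul _ _), integral_congr_ae h2, integral_const_mul,
        ← Finset.mul_sum, ha.1 η hη]
      ring
    · have h : (fun x => tr ((c • a.fst) x)) =ᵐ[vol Ω] fun x => c * tr (a.fst x) := by
        filter_upwards [Lp.coeFn_smul c a.fst] with x hx
        rw [hx]; simp [tr, Finset.mul_sum]
      simp only [WithLp.smul_fst]
      refine ⟨(integrable_congr h).2 (ha.2.1.const_mul c), ?_⟩
      rw [integral_congr_ae h, integral_const_mul, ha.2.2, mul_zero]

/-- `w` is the trace of `v ∈ H¹(Ω)` on the `(n-1)`-dimensional set `S ⊆ closure Ω`: the limit in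
`L²(S)` of the restrictions of continuous `H¹` fields that converge to `v` in `H¹(Ω)`. -/
def HasTrace {n m : ℕ} {Ω : Set (Vec n)} (v : H1 Ω m) (S : Set (Vec n)) (w : Vec n → Vec m) :
    Prop :=
  AEStronglyMeasurable w ((surf n).restrict S) ∧
    ∃ (u : ℕ → H1 Ω m) (f : ℕ → C(Vec n, Vec m)),
      (∀ l, fld (u l) =ᵐ[vol Ω] f l) ∧ Tendsto u atTop (𝓝 v) ∧
      Tendsto (fun l => eLpNorm (fun x => f l x - w x) 2 ((surf n).restrict S)) atTop (𝓝 0)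

theorem HasTrace.add {n m : ℕ} {Ω S : Set (Vec n)} {v v' : H1 Ω m} {w w' : Vec n → Vec m}
    (h : HasTrace v S w) (h' : HasTrace v' S w') : HasTrace (v + v') S (w + w') := by
  obtain ⟨hw, u, f, hu, huv, hf⟩ := h
  obtain ⟨hw', u', f', hu', huv', hf'⟩ := h'
  refine ⟨hw.add hw', fun l => u l + u' l, fun l => f l + f' l, fun l => ?_, huv.add huv', ?_⟩
  · have := Lp.coeFn_add (fld (u l)) (fld (u' l))
    filter_upwards [hu l, hu' l, this] with x h1 h2 h3
    have : fld (u l + u' l) = fld (u l) + fld (u' l) := rfl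
    rw [this, h3, Pi.add_apply, h1, h2]
    rfl
  · refine tendsto_of_tendsto_of_tendsto_of_le_of_le tendsto_const_nhds
      (by simpa using hf.add hf') (fun _ => zero_le) fun l => ?_
    have e : (fun x => (f l + f' l) x - (w + w') x) =
        (fun x => f l x - w x) + fun x => f' l x - w' x := by
      funext x
      simp only [ContinuousMap.add_apply, Pi.add_apply]
      abel
    simp only [e]
    exact eLpNorm_add_le ((f l).continuous.aestronglyMeasurable.sub hw)
      ((f' l).continuous.aestronglyMeasurable.sub hw') (by norm_num)

theorem HasTrace.smul {n m : ℕ} {Ω S : Set (Vec n)} {v : H1 Ω m} {w : Vec n → Vec m}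
    (h : HasTrace v S w) (c : ℝ) : HasTrace (c • v) S (c • w) := by
  obtain ⟨hw, u, f, hu, huv, hf⟩ := h
  refine ⟨hw.const_smul c, fun l => c • u l, fun l => c • f l, fun l => ?_, huv.const_smul c, ?_⟩
  · have := Lp.coeFn_smul c (fld (u l))
    filter_upwards [hu l, this] with x h1 h3
    have : fld (c • u l) = c • fld (u l) := rfl
    rw [this, h3, Pi.smul_apply, h1]
    rfl
  · have e : ∀ l, (fun x => (c • f l) x - (c • w) x) = c • fun x => f l x - w x := by
      intro l
      funext x
      simp [smul_sub]
    simp only [e, eLpNorm_const_smul]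
    simpa using ENNReal.Tendsto.const_mul hf (Or.inr (by simp : ‖c‖ₑ ≠ ⊤))

/-- `{v ∈ H¹(Ω) : v|_S = 0}`: this is `H¹₀(Ω)` for `S = ∂Ω` and `H¹_{Γ_D}(Ω)` for `S = Γ_D`. -/
def H1zero {n : ℕ} (Ω S : Set (Vec n)) (m : ℕ) : Submodule ℝ (H1 Ω m) where
  carrier := {v | HasTrace v S 0}
  zero_mem' := by
    refine ⟨aestronglyMeasurable_const, fun _ => 0, fun _ => 0, fun _ => ?_,
      tendsto_const_nhds, by simp⟩
    exact Lp.coeFn_zero (Vec m) 2 (vol Ω)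
  add_mem' := by
    intro a b ha hb
    have h := HasTrace.add ha hb
    rwa [add_zero] at h
  smul_mem' := by
    intro c a ha
    have h := HasTrace.smul ha c
    rwa [smul_zero] at h

/-- `H¹₀(Ω)` for velocities. -/
abbrev H10 {n : ℕ} (Ω : Set (Vec n)) := H1zero Ω (frontier Ω) n

/-- The space `ℍ = L²_tr(Ω) × H₀(div; Ω) × H¹₀(Ω)` with its Hilbertian product norm. -/
abbrev FlowSpace {n : ℕ} (Ω : Set (Vec n)) := WithLp 2 (L2tr Ω × WithLp 2 (Hdiv0 Ω × H10 Ω))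

namespace FlowSpace

variable {n : ℕ} {Ω : Set (Vec n)}

/-- The strain `t`. -/
def t (x : FlowSpace Ω) : Lp (Tens n n) 2 (vol Ω) := (WithLp.fst x : L2tr Ω)

/-- The pseudostress, as an element of `H₀(div; Ω)`. -/
def sigElt (x : FlowSpace Ω) : Hdiv0 Ω := WithLp.fst (WithLp.snd x)

/-- The pseudostress `σ`. -/
def sig (x : FlowSpace Ω) : Lp (Tens n n) 2 (vol Ω) :=
  (sigElt x : WithLp 2 (Lp (Tens n n) 2 (vol Ω) × Lp (Vec n) 2 (vol Ω))).fst

/-- The divergence `div σ`. -/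
def divSig (x : FlowSpace Ω) : Lp (Vec n) 2 (vol Ω) :=
  (sigElt x : WithLp 2 (Lp (Tens n n) 2 (vol Ω) × Lp (Vec n) 2 (vol Ω))).snd

/-- The velocity, as an element of `H¹₀(Ω)`. -/
def vel (x : FlowSpace Ω) : H10 Ω := WithLp.snd (WithLp.snd x)

/-- The velocity `u`. -/
def u (x : FlowSpace Ω) : Lp (Vec n) 2 (vol Ω) := fld (vel x : H1 Ω n)

/-- The velocity gradient `∇u`. -/
def gradU (x : FlowSpace Ω) : Lp (Tens n n) 2 (vol Ω) := grd (vel x : H1 Ω n)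

end FlowSpace

/-! ### Domain, boundary and data -/

/-- A bounded domain of `ℝⁿ` with polygonal/polyhedral boundary: a connected open set, lying
nowhere on both sides of its boundary, whose closure is a finite union of simplices. -/
structure IsPolyhedralDomain {n : ℕ} (Ω : Set (Vec n)) : Prop where
  isOpen : IsOpen Ω
  connected : IsConnected Ω
  bounded : Bornology.IsBounded Ω
  regular : interior (closure Ω) = Ω
  polyhedral : ∃ T : Geometry.SimplicialComplex ℝ (Vec n), T.faces.Finite ∧ T.space = closure Ω

/-- The splitting of the boundary into a Dirichlet and a Neumann part. The relative boundary of
`Γ_D` is negligible, as it is for the usual (polygonal) boundary pieces. -/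
structure IsBoundarySplit {n : ℕ} (Ω ΓD ΓN : Set (Vec n)) : Prop where
  subset_D : ΓD ⊆ frontier Ω
  subset_N : ΓN ⊆ frontier Ω
  disjoint : Disjoint ΓD ΓN
  cover : frontier Ω = closure ΓD ∪ closure ΓN
  pos : 0 < surf n ΓD
  null_bdry : surf n (closure ΓD \ ΓD) = 0

/-- The physical data and stabilization parameters: `γ`, the viscosity `ν` with its constants
`ν₁, ν₂, L_ν`, the diffusivities `𝕂 = diag(k₁, k₂)` with their lower bound `k₀`, the expansion
coefficients `α`, the gravity `g`, and `κ₁, κ₂, κ₃`. -/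
structure Data (n : ℕ) where
  γ : ℝ
  ν : Vec 2 → ℝ
  ν₁ : ℝ
  ν₂ : ℝ
  Lν : ℝ
  K : Fin 2 → Vec n → ℝ
  k₀ : ℝ
  α : Vec 2
  g : Vec n
  κ₁ : ℝ
  κ₂ : ℝ
  κ₃ : ℝ

/-- The assumptions on the data and on the stabilization parameters. -/
structure Data.Admissible {n : ℕ} (d : Data n) (Ω : Set (Vec n)) : Prop where
  γ_pos : 0 < d.γ
  ν₁_pos : 0 < d.ν₁
  ν₂_pos : 0 < d.ν₂
  Lν_pos : 0 < d.Lν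
  ν_bounds : ∀ a, d.ν₁ ≤ d.ν a ∧ d.ν a ≤ d.ν₂
  ν_lip : ∀ a b, |d.ν a - d.ν b| ≤ d.Lν * ‖a - b‖
  K_meas : ∀ i, AEMeasurable (d.K i) (vol Ω)
  K_bdd : ∃ M, ∀ i, ∀ᵐ x ∂(vol Ω), |d.K i x| ≤ M
  k₀_pos : 0 < d.k₀
  K_pos : ∀ i, ∀ᵐ x ∂(vol Ω), d.k₀ ≤ d.K i x
  κ_range : ∃ δ₁ δ₂ δ₃ : ℝ, 0 < δ₁ ∧ δ₁ < 1 / d.ν₂ ∧ 0 < δ₂ ∧ δ₂ < 2 / d.γ ∧ 0 < δ₃ ∧ δ₃ < 1 ∧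
    0 < d.κ₁ ∧ d.κ₁ < 2 * δ₃ * (2 * d.ν₁ - d.κ₃ * d.ν₂ / δ₁) ∧
    0 < d.κ₂ ∧ d.κ₂ < 2 * δ₂ ∧
    0 < d.κ₃ ∧ d.κ₃ < 2 * d.ν₁ * δ₁ / d.ν₂

/-! ### The variational forms -/

section Forms

variable {n : ℕ} {Ω : Set (Vec n)} (d : Data n)

/-- The bilinear form `A_φ(x, y)` with `x = (t, σ, u)` and `y = (r, τ, v)`. -/
def formA (φ : H1 Ω 2) (x y : FlowSpace Ω) : ℝ :=
  2 * ∫ s, d.ν (fld φ s) * inner ℝ (x.t s) (y.t s - d.κ₃ • dev (y.sig s)) ∂(vol Ω)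
  + ∫ s, inner ℝ (x.t s) (dev (y.sig s) - d.κ₁ • symPart (y.gradU s)) ∂(vol Ω)
  - ∫ s, inner ℝ (dev (x.sig s)) (y.t s - d.κ₃ • dev (y.sig s)) ∂(vol Ω)
  + (1 - d.κ₂ * d.γ) * ∫ s, inner ℝ (x.u s) (y.divSig s) ∂(vol Ω)
  - ∫ s, inner ℝ (y.u s) (x.divSig s) ∂(vol Ω)
  + ∫ s, inner ℝ (skewPart (x.gradU s)) (y.sig s) ∂(vol Ω)
  - ∫ s, inner ℝ (x.sig s) (skewPart (y.gradU s)) ∂(vol Ω)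
  + d.γ * ∫ s, inner ℝ (x.u s) (y.u s) ∂(vol Ω)
  + d.κ₂ * ∫ s, inner ℝ (x.divSig s) (y.divSig s) ∂(vol Ω)
  + d.κ₁ * ∫ s, inner ℝ (symPart (x.gradU s)) (symPart (y.gradU s)) ∂(vol Ω)

/-- The form `B_w(x, y)`. -/
def formB (w : H10 Ω) (x y : FlowSpace Ω) : ℝ :=
  ∫ s, inner ℝ (dev (outer (x.u s) (fld (w : H1 Ω n) s)))
    (d.κ₃ • dev (y.sig s) - y.t s) ∂(vol Ω)

/-- The form `C(χ, ψ) = ∫ 𝕂 ∇χ : ∇ψ`. -/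
def formC (χ ψ : H1 Ω 2) : ℝ :=
  ∫ s, ∑ i, ∑ j, d.K i s * grd χ s (i, j) * grd ψ s (i, j) ∂(vol Ω)

/-- The functional `F_φ(y)`. -/
def functF (φ : H1 Ω 2) (y : FlowSpace Ω) : ℝ :=
  ∫ s, inner ℝ d.α (fld φ s) * inner ℝ d.g (y.u s - d.κ₂ • y.divSig s) ∂(vol Ω)

/-- The functional `G_{w,φ}(ψ)`. -/
def functG (w : H10 Ω) (φ ψ : H1 Ω 2) : ℝ :=
  -∫ s, inner ℝ (tensMul (grd φ s) (fld (w : H1 Ω n) s)) (fld ψ s) ∂(vol Ω)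

/-- `x` solves the linearized flow problem with given `(w, φ)`. -/
def SolvesFlow (w : H10 Ω) (φ : H1 Ω 2) (x : FlowSpace Ω) : Prop :=
  ∀ y : FlowSpace Ω, formA d φ x y + formB d w x y = functF d φ y

/-- `(x, φ)` solves the continuous problem with Dirichlet datum `φ_D`, and `(u, φ) ∈ W_r`. -/
structure IsSolution (ΓD : Set (Vec n)) (φD : Vec n → Vec 2) (r : ℝ) (x : FlowSpace Ω) (φ : H1 Ω 2) :
    Prop where
  dirichlet : HasTrace φ ΓD φD
  flow : SolvesFlow d x.vel φ x
  transport : ∀ ψ ∈ H1zero Ω ΓD 2, formC d φ ψ = functG x.vel φ ψ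
  ball : ‖x.vel‖ + ‖φ‖ ≤ r

/-- `E(φ_D)`: the extension of `φ_D` of minimal `H¹` norm. -/
def IsMinExtension (ΓD : Set (Vec n)) (φD : Vec n → Vec 2) (E : H1 Ω 2) : Prop :=
  HasTrace E ΓD φD ∧ ∀ χ : H1 Ω 2, HasTrace χ ΓD φD → ‖E‖ ≤ ‖χ‖

end Forms

/-! ### Triangulations and finite element spaces -/

/-- A finite conforming triangulation of `closure Ω` by `n`-simplices, such that `closure Γ_D` is
a union of facets. -/
structure IsMesh {n : ℕ} (Ω ΓD : Set (Vec n)) (T : Geometry.SimplicialComplex ℝ (Vec n)) :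
    Prop where
  finite : T.faces.Finite
  space : T.space = closure Ω
  pure : ∀ s ∈ T.faces, ∃ K ∈ T.faces, s ⊆ K ∧ K.card = n + 1
  dirichlet : ∀ x ∈ closure ΓD, ∃ e ∈ T.faces, e.card = n ∧
    x ∈ convexHull ℝ (e : Set (Vec n)) ∧ convexHull ℝ (e : Set (Vec n)) ⊆ closure ΓD

/-- The elements of a triangulation. -/
def elements {n : ℕ} (T : Geometry.SimplicialComplex ℝ (Vec n)) : Set (Finset (Vec n)) :=
  {K | K ∈ T.faces ∧ K.card = n + 1}

/-- The value of a polynomial at a point. -/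
def peval {n : ℕ} (p : MvPolynomial (Fin n) ℝ) (x : Vec n) : ℝ := MvPolynomial.eval (fun j => x j) p

section FE

variable {n : ℕ} (Ω ΓD : Set (Vec n)) (T : Geometry.SimplicialComplex ℝ (Vec n)) (k : ℕ)

/-- Piecewise polynomials of degree `≤ k`, for the strain. -/
def feStrain (r : Lp (Tens n n) 2 (vol Ω)) : Prop :=
  ∀ K ∈ elements T, ∃ p : Fin n × Fin n → MvPolynomial (Fin n) ℝ,
    (∀ q, (p q).totalDegree ≤ k) ∧
    ∀ᵐ x ∂(vol Ω), x ∈ convexHull ℝ (K : Set (Vec n)) → ∀ q, r x q = peval (p q) x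

/-- Tensor fields `τ` such that `cᵗ τ` is, on each element, in the Raviart-Thomas space
`P_k(K)ⁿ ⊕ P_k(K) x`, for all `c`. -/
def feStress (τ : Lp (Tens n n) 2 (vol Ω)) : Prop :=
  ∀ K ∈ elements T, ∀ c : Vec n,
    ∃ (p : Fin n → MvPolynomial (Fin n) ℝ) (q : MvPolynomial (Fin n) ℝ),
      (∀ j, (p j).totalDegree ≤ k) ∧ q.totalDegree ≤ k ∧
      ∀ᵐ x ∂(vol Ω), x ∈ convexHull ℝ (K : Set (Vec n)) →
        ∀ j, ∑ i, c i * τ x (i, j) = peval (p j) x + peval q x * x j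

variable {Ω} in
/-- `v` belongs to the Lagrange space of degree `≤ k + 1`, and `f` is (an extension to `ℝⁿ` of)
its continuous representative on `closure Ω`. -/
def IsLagrange {m : ℕ} (v : H1 Ω m) (f : C(Vec n, Vec m)) : Prop :=
  fld v =ᵐ[vol Ω] f ∧ ∀ K ∈ elements T, ∃ p : Fin m → MvPolynomial (Fin n) ℝ,
    (∀ i, (p i).totalDegree ≤ k + 1) ∧
    ∀ x ∈ convexHull ℝ (K : Set (Vec n)), ∀ i, f x i = peval (p i) x

/-- The Lagrange space `H_h^φ`. -/
def lagrange : Set (H1 Ω 2) := {φ | ∃ f, IsLagrange T k φ f}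

/-- The Lagrange fields that vanish on `Γ_D`. -/
def lagrangeDir : Set (H1 Ω 2) := {φ | ∃ f, IsLagrange T k φ f ∧ ∀ x ∈ ΓD, f x = 0}

/-- The space `ℍ_h`. -/
def flowFE : Set (FlowSpace Ω) :=
  {x | feStrain Ω T k x.t ∧ feStress Ω T k x.sig ∧
    ∃ f, IsLagrange T k (x.vel : H1 Ω n) f ∧ ∀ s ∈ frontier Ω, f s = 0}

/-- The Lagrange nodes of degree `k + 1`: the points of the elements whose barycentric coordinates
are multiples of `1 / (k + 1)`. -/
def IsNode (a : Vec n) : Prop :=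
  ∃ K ∈ elements T, ∃ c : Vec n → ℕ, ∑ p ∈ K, c p = k + 1 ∧
    a = ∑ p ∈ K, ((c p : ℝ) / (k + 1)) • p

/-- The simplex `σ` may be assigned to the node `a` in the Scott-Zhang construction: it is the
element with `a` in its interior if there is one, and otherwise a facet containing `a`, which lies
in `∂Ω` if `a` does, and in `closure Γ_D` if `a` does. -/
def IsNodeSimplex (a : Vec n) (σ : Finset (Vec n)) : Prop :=
  (σ ∈ elements T ∧ a ∈ interior (convexHull ℝ (σ : Set (Vec n)))) ∨
  ((∀ K ∈ elements T, a ∉ interior (convexHull ℝ (K : Set (Vec n)))) ∧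
    σ ∈ T.faces ∧ σ.card = n ∧ a ∈ convexHull ℝ (σ : Set (Vec n)) ∧
    (a ∈ frontier Ω → convexHull ℝ (σ : Set (Vec n)) ⊆ frontier Ω) ∧
    (a ∈ closure ΓD → convexHull ℝ (σ : Set (Vec n)) ⊆ closure ΓD))

/-- The measure on the simplex of a node: volume on an element, surface measure on a facet. -/
def simplexMeasure (σ : Finset (Vec n)) : Measure (Vec n) :=
  (if σ.card = n + 1 then volume else surf n).restrict (convexHull ℝ (σ : Set (Vec n)))

/-- `I : H¹(Ω) → H_h^φ` is a Scott-Zhang interpolation operator of degree `k + 1`: its value at a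
node `a` is `∫_σ θ v`, where `σ` is the simplex of `a` and `θ ∈ P_{k+1}(σ)` is the dual basis
function of `a`, i.e. `∫_σ θ p = p(a)` for all `p ∈ P_{k+1}(σ)`; on a facet, `v` is understood in
the sense of traces. -/
def IsScottZhang (I : H1 Ω 2 → H1 Ω 2) : Prop :=
  ∃ (σ : Vec n → Finset (Vec n)) (θ : Vec n → MvPolynomial (Fin n) ℝ),
    (∀ a, IsNode T k a → IsNodeSimplex Ω ΓD T a (σ a) ∧ (θ a).totalDegree ≤ k + 1 ∧
      ∀ p : MvPolynomial (Fin n) ℝ, p.totalDegree ≤ k + 1 →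
        ∫ x, peval (θ a) x * peval p x ∂(simplexMeasure (σ a)) = peval p a) ∧
    ∀ v : H1 Ω 2, ∃ f, IsLagrange T k (I v) f ∧ ∀ a, IsNode T k a →
      ((σ a).card = n + 1 →
        f a = ∫ x in Ω, peval (θ a) x • fld v x ∂(simplexMeasure (σ a))) ∧
      ((σ a).card = n → ∀ w, HasTrace v (convexHull ℝ (σ a : Set (Vec n))) w →
        f a = ∫ x, peval (θ a) x • w x ∂(simplexMeasure (σ a)))

/-- `(x, φ)` solves the Galerkin scheme, in which the discrete Dirichlet datum is the restriction
to `Γ_D` of `I(E)`, and `(u_h, φ_h) ∈ W_r^h`. -/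
structure IsDiscreteSolution (d : Data n) (I : H1 Ω 2 → H1 Ω 2) (E : H1 Ω 2) (r : ℝ)
    (x : FlowSpace Ω) (φ : H1 Ω 2) : Prop where
  mem_flow : x ∈ flowFE Ω T k
  mem_lagrange : φ ∈ lagrange Ω T k
  dirichlet : φ - I E ∈ lagrangeDir Ω ΓD T k
  flow : ∀ y ∈ flowFE Ω T k, formA d φ x y + formB d x.vel x y = functF d φ y
  transport : ∀ ψ ∈ lagrangeDir Ω ΓD T k, formC d φ ψ = functG x.vel φ ψ
  ball : ‖x.vel‖ + ‖φ‖ ≤ r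

end FE

/-! ### The constants

Embedding constants are least constants in `[0, ∞]`. -/

section Constants

variable {n : ℕ} (Ω ΓD : Set (Vec n)) (d : Data n)

/-- `c₁(Ω) = ‖i‖²` for the injection `i : H¹(Ω) → L⁴(Ω)`. -/
def c₁ : ℝ≥0∞ :=
  sInf {C | ∀ v : H1 Ω n, eLpNorm (fld v) 4 (vol Ω) ^ 2 ≤ C * ENNReal.ofReal (‖v‖ ^ 2)}

/-- The constant `c_gp` of the generalized Poincaré inequality on `H¹_{Γ_D}(Ω)`. -/
def cgp : ℝ≥0∞ :=
  sInf {C | ∀ ψ ∈ H1zero Ω ΓD 2, ENNReal.ofReal ‖ψ‖ ≤ C * ENNReal.ofReal ‖grd ψ‖}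

/-- The ellipticity constant of `C` on `H¹_{Γ_D}(Ω)`, `α̃ = k₀ c_gp⁻²`. -/
def αt : ℝ≥0∞ := ENNReal.ofReal d.k₀ / cgp Ω ΓD ^ 2

/-- The ellipticity constant `α(Ω)` of the forms `A_φ`, uniformly in `φ`. -/
def αΩ : ℝ :=
  sSup {a : ℝ | ∀ (φ : H1 Ω 2) (x : FlowSpace Ω), a * ‖x‖ ^ 2 ≤ formA d φ x x}

/-- `(2 + κ₂²)^{1/2}`. -/
def root₂ : ℝ≥0∞ := ENNReal.ofReal (Real.sqrt (2 + d.κ₂ ^ 2))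

/-- `(2 + κ₃²)^{1/2}`. -/
def root₃ : ℝ≥0∞ := ENNReal.ofReal (Real.sqrt (2 + d.κ₃ ^ 2))

/-- The radius `r₀ = α(Ω) / (2 c₁(Ω) (2 + κ₃²)^{1/2})`. -/
def r₀ : ℝ≥0∞ := ENNReal.ofReal (αΩ Ω d) / (2 * c₁ Ω * root₃ d)

/-- The a priori constant `2 √2 (2 + κ₂²)^{1/2} / α(Ω)` of the flow problem. -/
def CA : ℝ≥0∞ := 2 * ENNReal.ofReal (Real.sqrt 2) * root₂ d / ENNReal.ofReal (αΩ Ω d)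

/-- The `H^ε` norm (Sobolev-Slobodeckij) of a tensor field, `0 < ε < 1`. -/
def fracNorm {Ω : Set (Vec n)} (ε : ℝ) (t : Lp (Tens n n) 2 (vol Ω)) : ℝ≥0∞ :=
  (eLpNorm t 2 (vol Ω) ^ 2 +
    ∫⁻ x, ∫⁻ y, ‖t x - t y‖ₑ ^ 2 / edist x y ^ ((n : ℝ) + 2 * ε) ∂(vol Ω) ∂(vol Ω)) ^ (1 / 2 : ℝ)

/-- The constant `C_ε` of the injection `H^ε(Ω) → L^{2p}(Ω)`, `2p = 2n / (n - 2ε)`. -/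
def Cε (ε : ℝ) : ℝ≥0∞ :=
  sInf {C | ∀ t : Lp (Tens n n) 2 (vol Ω), fracNorm ε t < ⊤ →
    eLpNorm t (ENNReal.ofReal (2 * n / (n - 2 * ε))) (vol Ω) ≤ C * fracNorm ε t}

/-- The constant of the injection `H¹(Ω) → L^{n/ε}(Ω)`. -/
def Cεt (ε : ℝ) : ℝ≥0∞ :=
  sInf {C | ∀ φ : H1 Ω 2,
    eLpNorm (fld φ) (ENNReal.ofReal (n / ε)) (vol Ω) ≤ C * ENNReal.ofReal ‖φ‖}

/-- The bound `C_A + c₁(Ω) (2 + κ₃²)^{1/2} r` for the norm of `A_φ + B_w`, `‖w‖₁ ≤ r`, where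
`C_A = 3 max{2, γ + κ₁, κ₂ + κ₃, 2ν₂, 1 + 2ν₂κ₃, 1 + |1 - γκ₂|}`. -/
def normAB (r : ℝ) : ℝ≥0∞ :=
  ENNReal.ofReal (3 * max 2 (max (d.γ + d.κ₁) (max (d.κ₂ + d.κ₃) (max (2 * d.ν₂)
    (max (1 + 2 * d.ν₂ * d.κ₃) (1 + |1 - d.γ * d.κ₂|)))))) +
  c₁ Ω * root₃ d * ENNReal.ofReal r

/-- The constant `C_ST` of the Strang-type estimate. -/
def CST (r ε : ℝ) : ℝ≥0∞ :=
  2 / ENNReal.ofReal (αΩ Ω d) * max 1 (normAB Ω d r) *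
    max (ENNReal.ofReal (Real.sqrt 2) * root₂ d)
      (max (2 * ENNReal.ofReal d.Lν * Cε Ω ε * Cεt Ω ε * root₃ d)
        (max (c₁ Ω * root₃ d) (1 + 2 * normAB Ω d r)))

/-- The constant `C₁ = C_ST (1 + r Ĉ(r) + r C_A)`. -/
def C₁ (r ε Chat : ℝ) : ℝ≥0∞ :=
  CST Ω d r ε * (1 + ENNReal.ofReal (r * Chat) + ENNReal.ofReal r * CA Ω d)

/-- The regularity assumption on the linearized flow problems: their strains are in `H^ε(Ω)`,
with `‖t‖_ε ≤ Ĉ(r) |α| |g| ‖φ‖₀`. -/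
def FlowRegularity (r ε Chat : ℝ) : Prop :=
  ∀ (w : H10 Ω) (φ : H1 Ω 2), ‖w‖ + ‖φ‖ ≤ r → ∀ x : FlowSpace Ω, SolvesFlow d w φ x →
    fracNorm ε x.t ≤ ENNReal.ofReal (Chat * ‖d.α‖ * ‖d.g‖ * ‖fld φ‖)

end Constants

end

end DoubleDiffusion

namespace DoubleDiffusion

noncomputable section

/-! The estimate is Céa–Strang for two coupled Galerkin problems, in which the coupling terms are
small enough to be absorbed.

Flow. For a discrete y, put z = x_h - y and e = x - y. Since ‖u_h‖₁ ≤ r < r₀, the form A_{φ_h} +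
B_{u_h} is coercive with constant α(Ω)/2 (`le_formA_add_formB`). Testing both flow problems with z
gives (A_{φ_h} + B_{u_h})(z, z) = -F_{φ-φ_h}(z) + (A_φ - A_{φ_h})(x, z) + B_{u-u_h}(x, z) + (A_{φ_h}
+ B_{u_h})(e, z). The first two terms on the right are bounded by multiples of ‖φ - φ_h‖₁. For the
second, only the viscosity depends on φ, and Hölder's inequality pairs φ - φ_h in L^{n/ε} with the
strain in L^{2n/(n-2ε)}, where the regularity assumption bounds it (`abs_formA_sub_field_le`). The
third is bounded through the a priori bound of x (`norm_le_of_solvesFlow`). This is `flow_error_le`: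
‖z‖ ≤ P‖φ-φ_h‖ + Q‖x-x_h‖ + M‖e‖, and the second smallness assumption gives P + Q ≤ 1/2.

Transport. Scott–Zhang values at nodes of the closure of Γ_D depend only on the trace there, so ψ =
φ_h - Iφ vanishes on Γ_D and is admissible in both transport equations
(`IsScottZhang.sub_mem_lagrangeDir`). Ellipticity of C, the Poincaré inequality and the first
smallness assumption give `transport_error_le`: ‖ψ‖ ≤ (‖u-u_h‖ + ‖φ-φ_h‖)/2 + N‖φ-Iφ‖.

Simply adding the two estimates might leave no margin: the absorbed parts can make up the whole
error. Eliminating ‖φ-φ_h‖ first does (`sum_le_of_coupled`). None of P, Q, M, N depends on the mesh.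

The embedding constants live in [0, ∞], so their finiteness must be extracted from the smallness
assumptions before the computation can be done with real numbers. -/

/-! ### Polynomials vanishing on lattices -/

/-- A polynomial of degree at most `N` that vanishes at the points of `ℕ^σ` with coordinate sum
at most `N` is zero. -/
theorem eq_zero_of_eval_lattice {σ : Type*} [Fintype σ] {N : ℕ} (q : MvPolynomial σ ℝ)
    (hq : q.totalDegree ≤ N)
    (h : ∀ c : σ → ℕ, ∑ i, c i ≤ N → MvPolynomial.eval (fun i => (c i : ℝ)) q = 0) : q = 0 := by
  classical
  by_contra hne
  obtain ⟨t, ht, htd⟩ := Finset.exists_mem_eq_sup q.support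
    (by simpa [Finset.nonempty_iff_ne_empty] using hne) (fun s => Finsupp.degree s)
  have htd' : q.totalDegree = t.degree := by
    rw [← htd]
    rfl
  -- For a monomial t of top degree, the grid ∏ {0, …, t i} has t i + 1 values in each direction, so
  -- q is nonzero somewhere on it. The coordinates there sum to at most |t| = deg q ≤ N.
  obtain ⟨s, hs, hs0⟩ := MvPolynomial.combinatorial_nullstellensatz_exists_eval_nonzero q t
    (MvPolynomial.mem_support_iff.1 ht) htd'
    (fun i => (Finset.range (t i + 1)).map Nat.castEmbedding) (fun i => by simp)
  have hs' : ∀ i, ∃ c : ℕ, c ≤ t i ∧ (c : ℝ) = s i := fun i => by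
    obtain ⟨c, hc, e⟩ := Finset.mem_map.1 (hs i)
    exact ⟨c, Nat.lt_succ_iff.1 (Finset.mem_range.1 hc), e⟩
  choose c hc e using hs'
  refine hs0 ?_
  have : s = fun i => (c i : ℝ) := funext fun i => (e i).symm
  rw [this]
  refine h c (le_trans (Finset.sum_le_sum fun i _ => hc i) ?_)
  rw [← Finsupp.degree_eq_sum, ← htd']
  exact hq

/-- Substituting polynomials of degree at most one does not increase the degree. -/
theorem totalDegree_bind₁_le {σ τ : Type*} (f : σ → MvPolynomial τ ℝ)
    (hf : ∀ i, (f i).totalDegree ≤ 1) (p : MvPolynomial σ ℝ) :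
    (MvPolynomial.bind₁ f p).totalDegree ≤ p.totalDegree := by
  conv_lhs => rw [p.as_sum, map_sum]
  refine MvPolynomial.totalDegree_finsetSum_le fun s hs => ?_
  rw [MvPolynomial.bind₁_monomial]
  refine (MvPolynomial.totalDegree_mul _ _).trans ?_
  rw [MvPolynomial.totalDegree_C, zero_add]
  refine (MvPolynomial.totalDegree_finsetProd _ _).trans ?_
  refine le_trans (Finset.sum_le_sum (g := fun i => s i) fun i _ => ?_)
    (MvPolynomial.le_totalDegree hs)
  refine (MvPolynomial.totalDegree_pow _ _).trans ?_
  simpa using Nat.mul_le_mul_left (s i) (hf i)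

/-- A polynomial of degree at most `N` that vanishes at the lattice points of order `N` of a
simplex vanishes on the simplex. -/
theorem peval_eq_zero_of_lattice {n N : ℕ} (hN : 0 < N) (p : MvPolynomial (Fin n) ℝ)
    (hp : p.totalDegree ≤ N) (e : Finset (Vec n))
    (h : ∀ c : Vec n → ℕ, ∑ v ∈ e, c v = N → peval p (∑ v ∈ e, ((c v : ℝ) / N) • v) = 0)
    {x : Vec n} (hx : x ∈ convexHull ℝ (e : Set (Vec n))) : peval p x = 0 := by
  classical
  have hN' : (N : ℝ) ≠ 0 := by positivity
  rw [Finset.mem_convexHull'] at hx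
  obtain ⟨w, hw0, hw1, rfl⟩ := hx
  obtain ⟨v₀, hv₀⟩ : e.Nonempty := by
    by_contra hne
    rw [Finset.not_nonempty_iff_eq_empty] at hne
    simp [hne] at hw1
  -- Coordinates of the affine map c ↦ v₀ + ∑ (c v / N)(v - v₀). The entry c v₀ has no effect, so a
  -- multi-index of sum at most N can be completed at v₀ to sum exactly N without moving the point;
  -- this is `c₁` below.
  let f : Fin n → MvPolynomial e ℝ := fun j =>
    MvPolynomial.C (v₀ j) + ∑ v : e, MvPolynomial.C ((v.1 j - v₀ j) / N) * MvPolynomial.X v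
  have hf : ∀ j, (f j).totalDegree ≤ 1 := fun j => by
    refine (MvPolynomial.totalDegree_add _ _).trans (max_le (by simp) ?_)
    refine MvPolynomial.totalDegree_finsetSum_le fun v _ => ?_
    refine (MvPolynomial.totalDegree_mul _ _).trans ?_
    simp
  have hev : ∀ c : Vec n → ℝ, MvPolynomial.eval (fun v : e => c v) (MvPolynomial.bind₁ f p) =
      peval p (v₀ + ∑ v ∈ e, (c v / N) • (v - v₀)) := fun c => by
    rw [peval, MvPolynomial.eval, MvPolynomial.eval₂Hom_bind₁]
    congr 2
    funext j
    simp only [f, map_add, map_sum, map_mul, MvPolynomial.coe_eval₂Hom, MvPolynomial.eval₂_C,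
      MvPolynomial.eval₂_X, RingHom.id_apply, PiLp.add_apply, WithLp.ofLp_sum, Finset.sum_apply,
      PiLp.smul_apply, PiLp.sub_apply, smul_eq_mul, Finset.univ_eq_attach]
    rw [← Finset.sum_attach e fun v => c v / N * (v j - v₀ j)]
    congr 1
    exact Finset.sum_congr rfl fun v _ => by ring
  have hcomb : ∀ c : Vec n → ℝ, ∑ v ∈ e, c v = N →
      v₀ + ∑ v ∈ e, (c v / N) • (v - v₀) = ∑ v ∈ e, (c v / N) • v := fun c hc => by
    have h1 : ∑ v ∈ e, c v / (N : ℝ) = 1 := by rw [← Finset.sum_div, hc, div_self hN']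
    simp only [smul_sub, Finset.sum_sub_distrib, ← Finset.sum_smul, h1, one_smul]
    abel
  have hq : MvPolynomial.bind₁ f p = 0 := by
    refine eq_zero_of_eval_lattice _ ((totalDegree_bind₁_le f hf p).trans hp) fun c hc => ?_
    let c₀ : Vec n → ℕ := fun v => if hv : v ∈ e then c ⟨v, hv⟩ else 0
    have hc₀ : ∑ v ∈ e, c₀ v ≤ N := by
      rw [← Finset.sum_attach]
      simpa [c₀] using hc
    let c₁ : Vec n → ℕ := Function.update c₀ v₀ (N - ∑ v ∈ e.erase v₀, c₀ v)
    have hle : ∑ v ∈ e.erase v₀, c₀ v ≤ N :=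
      (Finset.sum_le_sum_of_subset (Finset.erase_subset _ _)).trans hc₀
    have he : ∀ v ∈ e.erase v₀, c₁ v = c₀ v := fun v hv =>
      Function.update_of_ne (Finset.ne_of_mem_erase hv) _ _
    have hc₁ : ∑ v ∈ e, c₁ v = N := by
      rw [← Finset.add_sum_erase e _ hv₀, Finset.sum_congr rfl he]
      simp [c₁, Nat.sub_add_cancel hle]
    have hco : (fun i : e => (c i : ℝ)) = fun v : e => ((fun u => (c₀ u : ℝ)) v) := by
      funext v
      simp [c₀]
    rw [hco, hev fun u => (c₀ u : ℝ)]
    have hsum : ∑ v ∈ e, ((c₀ v : ℝ) / N) • (v - v₀) = ∑ v ∈ e, ((c₁ v : ℝ) / N) • (v - v₀) := by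
      rw [← Finset.add_sum_erase e _ hv₀, ← Finset.add_sum_erase e
        (fun v => ((c₁ v : ℝ) / N) • (v - v₀)) hv₀]
      simp only [sub_self, smul_zero, zero_add]
      exact Finset.sum_congr rfl fun v hv => by rw [he v hv]
    rw [hsum, hcomb (fun v => (c₁ v : ℝ)) (by exact_mod_cast hc₁)]
    exact h c₁ hc₁
  -- N times the barycentric coordinates of x are sent to x itself.
  have := hev fun v => N * w v
  rw [hq, map_zero, hcomb _ (by rw [← Finset.mul_sum, hw1, mul_one])] at this
  rw [this]
  congr 1
  exact Finset.sum_congr rfl fun v _ => by rw [mul_div_cancel_left₀ _ hN']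

/-! ### Finite element spaces -/

section FE

variable {n : ℕ} {Ω ΓD : Set (Vec n)} {T : Geometry.SimplicialComplex ℝ (Vec n)} {k : ℕ}

theorem coeFn_fld_sub {m : ℕ} (v v' : H1 Ω m) :
    fld (v - v') =ᵐ[vol Ω] fun x => fld v x - fld v' x :=
  Lp.coeFn_sub (fld v) (fld v')

theorem peval_sub (p q : MvPolynomial (Fin n) ℝ) (x : Vec n) :
    peval (p - q) x = peval p x - peval q x := by simp [peval]

theorem IsLagrange.sub {m : ℕ} {v v' : H1 Ω m} {f f' : C(Vec n, Vec m)}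
    (h : IsLagrange T k v f) (h' : IsLagrange T k v' f') : IsLagrange T k (v - v') (f - f') := by
  refine ⟨?_, fun K hK => ?_⟩
  · filter_upwards [coeFn_fld_sub v v', h.1, h'.1] with x h1 h2 h3
    rw [h1, h2, h3]
    rfl
  · obtain ⟨p, hp, hf⟩ := h.2 K hK
    obtain ⟨p', hp', hf'⟩ := h'.2 K hK
    refine ⟨fun i => p i - p' i, fun i => (MvPolynomial.totalDegree_sub _ _).trans
      (max_le (hp i) (hp' i)), fun x hx i => ?_⟩
    rw [peval_sub, ← hf x hx i, ← hf' x hx i]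
    rfl

theorem flowFE_sub {x y : FlowSpace Ω} (hx : x ∈ flowFE Ω T k) (hy : y ∈ flowFE Ω T k) :
    x - y ∈ flowFE Ω T k := by
  obtain ⟨hx1, hx2, f, hf, hf0⟩ := hx
  obtain ⟨hy1, hy2, g, hg, hg0⟩ := hy
  refine ⟨fun K hK => ?_, fun K hK c => ?_, f - g, hf.sub hg, fun s hs => ?_⟩
  · obtain ⟨p, hp, h⟩ := hx1 K hK
    obtain ⟨p', hp', h'⟩ := hy1 K hK
    refine ⟨fun i => p i - p' i, fun i => (MvPolynomial.totalDegree_sub _ _).trans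
      (max_le (hp i) (hp' i)), ?_⟩
    filter_upwards [h, h', Lp.coeFn_sub x.t y.t] with s h1 h2 h3 hs q
    have e : (x - y).t = x.t - y.t := rfl
    rw [e, h3, peval_sub, ← h1 hs, ← h2 hs]
    rfl
  · obtain ⟨p, q, hp, hq, h⟩ := hx2 K hK c
    obtain ⟨p', q', hp', hq', h'⟩ := hy2 K hK c
    refine ⟨fun i => p i - p' i, q - q', fun i => (MvPolynomial.totalDegree_sub _ _).trans
      (max_le (hp i) (hp' i)), (MvPolynomial.totalDegree_sub _ _).trans (max_le hq hq'), ?_⟩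
    filter_upwards [h, h', Lp.coeFn_sub x.sig y.sig] with s h1 h2 h3 hs j
    have e : (x - y).sig = x.sig - y.sig := rfl
    rw [e, h3, peval_sub, peval_sub]
    simp only [Pi.sub_apply, PiLp.sub_apply, mul_sub, Finset.sum_sub_distrib]
    rw [h1 hs, h2 hs]
    ring
  · rw [ContinuousMap.sub_apply, hf0 s hs, hg0 s hs, sub_zero]

theorem lagrangeDir_sub {φ ψ : H1 Ω 2} (hφ : φ ∈ lagrangeDir Ω ΓD T k)
    (hψ : ψ ∈ lagrangeDir Ω ΓD T k) : φ - ψ ∈ lagrangeDir Ω ΓD T k := by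
  obtain ⟨f, hf, hf0⟩ := hφ
  obtain ⟨g, hg, hg0⟩ := hψ
  exact ⟨f - g, hf.sub hg, fun s hs => by
    rw [ContinuousMap.sub_apply, hf0 s hs, hg0 s hs, sub_zero]⟩

/-- The continuous representative serves as its own approximating sequence. It vanishes on the
closure of Γ_D by continuity; passing to this closed set avoids any measurability of Γ_D. -/
theorem lagrangeDir_subset_H1zero {φ : H1 Ω 2} (hφ : φ ∈ lagrangeDir Ω ΓD T k) :
    φ ∈ H1zero Ω ΓD 2 := by
  obtain ⟨f, hf, hf0⟩ := hφ
  refine ⟨aestronglyMeasurable_const, fun _ => φ, fun _ => f, fun _ => hf.1,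
    tendsto_const_nhds, ?_⟩
  have h0 : eLpNorm (fun x => f x - (0 : Vec n → Vec 2) x) 2 ((surf n).restrict ΓD) = 0 := by
    have hc : ∀ x ∈ closure ΓD, f x = 0 := fun x hx =>
      closure_minimal (s := ΓD) (t := {x | f x = 0}) hf0
        (isClosed_eq f.continuous continuous_const) hx
    refine le_antisymm ((eLpNorm_mono_measure _ (Measure.restrict_mono subset_closure le_rfl)).trans
      (le_of_eq ?_)) zero_le
    rw [eLpNorm_congr_ae (g := 0), eLpNorm_zero]
    filter_upwards [ae_restrict_mem isClosed_closure.measurableSet] with x hx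
    simp [hc x hx]
  simp only [h0]
  exact tendsto_const_nhds

/-- Traces restrict to subsets, up to surface null sets. -/
theorem HasTrace.mono_closure {m : ℕ} {v : H1 Ω m} {S S' : Set (Vec n)} {w : Vec n → Vec m}
    (h : HasTrace v S w) (h0 : surf n (closure S \ S) = 0) (hS : S' ⊆ closure S) :
    HasTrace v S' w := by
  have hle : (surf n).restrict S' ≤ (surf n).restrict S := by
    have : S' ≤ᵐ[surf n] S := by
      refine (LE.le.eventuallyLE hS).trans ?_
      rw [ae_le_set]
      exact h0
    exact Measure.restrict_mono' this le_rfl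
  obtain ⟨hw, u, f, hu, huv, hf⟩ := h
  exact ⟨hw.mono_measure hle, u, f, hu, huv, tendsto_of_tendsto_of_tendsto_of_le_of_le
    tendsto_const_nhds hf (fun _ => zero_le) fun l => eLpNorm_mono_measure _ hle⟩

/-- Scott-Zhang interpolants of fields with the same trace on `Γ_D` agree there. -/
theorem IsScottZhang.sub_mem_lagrangeDir {ΓN : Set (Vec n)} (hΩ : IsPolyhedralDomain Ω)
    (hΓ : IsBoundarySplit Ω ΓD ΓN) (hT : IsMesh Ω ΓD T) {I : H1 Ω 2 → H1 Ω 2}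
    (hI : IsScottZhang Ω ΓD T k I) {φD : Vec n → Vec 2} {φ ψ : H1 Ω 2}
    (hφ : HasTrace φ ΓD φD) (hψ : HasTrace ψ ΓD φD) : I φ - I ψ ∈ lagrangeDir Ω ΓD T k := by
  classical
  obtain ⟨σ, θ, hσ, hI⟩ := hI
  obtain ⟨f, hf, hfa⟩ := hI φ
  obtain ⟨g, hg, hga⟩ := hI ψ
  have hΓcl : closure ΓD ⊆ frontier Ω := closure_minimal hΓ.subset_D isClosed_frontier
  have hnode : ∀ a, IsNode T k a → a ∈ closure ΓD → f a = g a := by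
    intro a ha haD
    -- A boundary node cannot be interior to an element, because the interior of the closure of Ω is
    -- Ω. Its simplex is therefore a facet in the closure of Γ_D, where both fields have trace φ_D
    -- up to a surface null set.
    rcases (hσ a ha).1 with ⟨hK, h_integ⟩ | ⟨-, -, hcard, -, -, hsub⟩
    · have h1 : convexHull ℝ (σ a : Set (Vec n)) ⊆ closure Ω := by
        rw [← hT.space]
        exact T.convexHull_subset_space hK.1
      have h2 : a ∈ Ω := by
        rw [← hΩ.regular]
        exact interior_mono h1 h_integ
      exact absurd h2 (hΩ.isOpen.frontier_eq ▸ hΓcl haD).2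
    · rw [(hfa a ha).2 hcard φD (hφ.mono_closure hΓ.null_bdry (hsub haD)),
        (hga a ha).2 hcard φD (hψ.mono_closure hΓ.null_bdry (hsub haD))]
  refine ⟨f - g, hf.sub hg, fun x hx => ?_⟩
  obtain ⟨e, he, -, hxe, heD⟩ := hT.dirichlet x (subset_closure hx)
  obtain ⟨K, hK, heK, hKcard⟩ := hT.pure e he
  obtain ⟨p, hp, hpf⟩ := (hf.sub hg).2 K ⟨hK, hKcard⟩
  have heK' : convexHull ℝ (e : Set (Vec n)) ⊆ convexHull ℝ (K : Set (Vec n)) :=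
    convexHull_mono (by exact_mod_cast heK)
  ext i
  rw [hpf x (heK' hxe) i]
  refine peval_eq_zero_of_lattice (Nat.add_one_pos k) (p i) (hp i) e (fun c hc => ?_) hxe
  have hmem : ∑ v ∈ e, ((c v : ℝ) / (k + 1 : ℕ)) • v ∈ convexHull ℝ (e : Set (Vec n)) := by
    rw [Finset.mem_convexHull']
    refine ⟨fun v => (c v : ℝ) / (k + 1 : ℕ), fun v _ => by positivity, ?_, rfl⟩
    rw [← Finset.sum_div, ← Nat.cast_sum, hc, div_self (by positivity)]
  -- A lattice point of the facet is a node of the surrounding element: extend its multi-index by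
  -- zero.
  have hnd : IsNode T k (∑ v ∈ e, ((c v : ℝ) / (k + 1 : ℕ)) • v) := by
    refine ⟨K, ⟨hK, hKcard⟩, fun v => if v ∈ e then c v else 0, ?_, ?_⟩
    · rw [← Finset.sum_subset heK fun v _ hv => if_neg hv, ← hc]
      exact Finset.sum_congr rfl fun v hv => if_pos hv
    · rw [← Finset.sum_subset heK fun v _ hv => by simp [hv]]
      exact Finset.sum_congr rfl fun v hv => by simp [hv]
  rw [← hpf _ (heK' hmem) i, ContinuousMap.sub_apply, hnode _ hnd (heD hmem), sub_self]
  rfl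

end FE

/-! ### Pointwise tensor operations as continuous linear maps -/

/-- Makes the dyadic product of two L⁴ fields an L² field, as the convective terms require. -/
instance holderTriple_four_four_two : ENNReal.HolderTriple 4 4 2 where
  inv_add_inv_eq_inv := by
    have h : (4 : ℝ≥0∞)⁻¹ = 2⁻¹ / 2 := by
      rw [ENNReal.div_eq_inv_mul, ← ENNReal.mul_inv (by simp) (by simp)]
      norm_num
    rw [h, ENNReal.add_halves]

/-- The deviatoric part as a continuous linear map. -/
def devL (n : ℕ) : Tens n n →L[ℝ] Tens n n :=
  LinearMap.toContinuousLinearMap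
    { toFun := dev
      map_add' := fun a b => by
        ext p
        simp only [dev, tr, PiLp.add_apply, Finset.sum_add_distrib, add_div]
        split_ifs <;> ring
      map_smul' := fun c a => by
        ext p
        simp only [dev, tr, PiLp.smul_apply, smul_eq_mul, ← Finset.mul_sum, mul_div_assoc,
          RingHom.id_apply]
        split_ifs <;> ring }

/-- The symmetric part as a continuous linear map. -/
def symL (n : ℕ) : Tens n n →L[ℝ] Tens n n :=
  LinearMap.toContinuousLinearMap
    { toFun := symPart
      map_add' := fun a b => by ext p; simp only [symPart, PiLp.add_apply]; ring
      map_smul' := fun c a => by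
        ext p; simp only [symPart, PiLp.smul_apply, smul_eq_mul, RingHom.id_apply]; ring }

/-- The skew-symmetric part as a continuous linear map. -/
def skewL (n : ℕ) : Tens n n →L[ℝ] Tens n n :=
  LinearMap.toContinuousLinearMap
    { toFun := skewPart
      map_add' := fun a b => by ext p; simp only [skewPart, PiLp.add_apply]; ring
      map_smul' := fun c a => by
        ext p; simp only [skewPart, PiLp.smul_apply, smul_eq_mul, RingHom.id_apply]; ring }

theorem devL_apply {n : ℕ} (τ : Tens n n) : devL n τ = dev τ := rfl

/-- Expanding the square gives |τᵈ|² = |τ|² - (tr τ)²/n. -/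
theorem norm_dev_le {n : ℕ} (τ : Tens n n) : ‖dev τ‖ ≤ ‖τ‖ := by
  refine le_of_sq_le_sq ?_ (norm_nonneg _)
  rw [EuclideanSpace.norm_sq_eq, EuclideanSpace.norm_sq_eq]
  have h : ∀ p : Fin n × Fin n, ‖dev τ p‖ ^ 2 =
      ‖τ p‖ ^ 2 + if p.1 = p.2 then (tr τ / n) ^ 2 - 2 * (tr τ / n) * τ p else 0 := by
    intro p
    simp only [dev, Real.norm_eq_abs, sq_abs]
    split_ifs <;> ring
  rw [Finset.sum_congr rfl fun p _ => h p, Finset.sum_add_distrib]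
  have h2 : ∑ p : Fin n × Fin n,
      (if p.1 = p.2 then (tr τ / n) ^ 2 - 2 * (tr τ / n) * τ p else 0) = -(tr τ ^ 2 / n) := by
    rw [Fintype.sum_prod_type]
    simp only [Finset.sum_ite_eq, Finset.mem_univ, if_true, Finset.sum_sub_distrib,
      ← Finset.mul_sum, Finset.sum_const, Finset.card_univ, Fintype.card_fin, nsmul_eq_mul]
    rcases Nat.eq_zero_or_pos n with rfl | hn
    · simp
    · have e : ∑ i, τ (i, i) = tr τ := rfl
      rw [e]
      field_simp
      ring
  rw [h2]
  have : 0 ≤ tr τ ^ 2 / n := by positivity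
  linarith

/-- The dyadic product, as a bilinear map of vectors of different dimensions. -/
def outerL (m n : ℕ) : Vec m →L[ℝ] Vec n →L[ℝ] Tens m n :=
  LinearMap.mkContinuous₂
    (LinearMap.mk₂ ℝ (fun u w => (WithLp.toLp 2 fun p => u p.1 * w p.2 : Tens m n))
      (fun u u' w => by ext p; simp [add_mul]) (fun c u w => by ext p; simp [mul_assoc])
      (fun u w w' => by ext p; simp [mul_add]) (fun c u w => by ext p; simp; ring)) 1
    (fun u w => by
      rw [one_mul]
      refine le_of_sq_le_sq (le_of_eq ?_) (by positivity)
      rw [mul_pow, EuclideanSpace.norm_sq_eq, EuclideanSpace.norm_sq_eq, EuclideanSpace.norm_sq_eq,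
        Fintype.sum_prod_type, Finset.sum_mul_sum]
      simp [mul_pow])

theorem outerL_apply {m n : ℕ} (u : Vec m) (w : Vec n) (p : Fin m × Fin n) :
    outerL m n u w p = u p.1 * w p.2 := rfl

theorem outerL_eq_outer {n : ℕ} (u w : Vec n) : outerL n n u w = outer u w := rfl

theorem norm_outerL_le (m n : ℕ) : ‖outerL m n‖ ≤ 1 :=
  LinearMap.mkContinuous₂_norm_le _ zero_le_one _

theorem inner_tensMul {m n : ℕ} (G : Tens m n) (w : Vec n) (v : Vec m) :
    inner ℝ (tensMul G w) v = inner ℝ G (outerL m n v w) := by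
  simp only [PiLp.inner_apply, tensMul, outerL_apply, Fintype.sum_prod_type]
  refine Finset.sum_congr rfl fun i _ => ?_
  simp only [RCLike.inner_apply, conj_trivial, Finset.mul_sum]
  exact Finset.sum_congr rfl fun j _ => by ring

/-! ### Components of the flow unknown -/

section Components

variable {n : ℕ} {Ω : Set (Vec n)}

theorem fld_sub {m : ℕ} (v v' : H1 Ω m) : fld (v - v') = fld v - fld v' := rfl

theorem grd_sub {m : ℕ} (v v' : H1 Ω m) : grd (v - v') = grd v - grd v' := rfl

theorem t_sub (x y : FlowSpace Ω) : (x - y).t = x.t - y.t := rfl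

theorem sig_sub (x y : FlowSpace Ω) : (x - y).sig = x.sig - y.sig := rfl

theorem divSig_sub (x y : FlowSpace Ω) : (x - y).divSig = x.divSig - y.divSig := rfl

theorem vel_sub (x y : FlowSpace Ω) : (x - y).vel = x.vel - y.vel := rfl

theorem u_sub (x y : FlowSpace Ω) : (x - y).u = x.u - y.u := rfl

theorem gradU_sub (x y : FlowSpace Ω) : (x - y).gradU = x.gradU - y.gradU := rfl

theorem norm_sq_H1 {m : ℕ} (v : H1 Ω m) : ‖v‖ ^ 2 = ‖fld v‖ ^ 2 + ‖grd v‖ ^ 2 :=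
  WithLp.prod_norm_sq_eq_of_L2
    (v : WithLp 2 (Lp (Vec m) 2 (vol Ω) × Lp (Tens m n) 2 (vol Ω)))

theorem norm_fld_le {m : ℕ} (v : H1 Ω m) : ‖fld v‖ ≤ ‖v‖ :=
  le_of_sq_le_sq (by rw [norm_sq_H1]; linarith [sq_nonneg (‖grd v‖)]) (norm_nonneg _)

theorem norm_grd_le {m : ℕ} (v : H1 Ω m) : ‖grd v‖ ≤ ‖v‖ :=
  le_of_sq_le_sq (by rw [norm_sq_H1]; linarith [sq_nonneg (‖fld v‖)]) (norm_nonneg _)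

theorem norm_nonneg_flow (x : FlowSpace Ω) : 0 ≤ ‖x‖ := norm_nonneg x

theorem norm_sq_flow (x : FlowSpace Ω) :
    ‖x‖ ^ 2 = ‖x.t‖ ^ 2 + ‖x.sig‖ ^ 2 + ‖x.divSig‖ ^ 2 + ‖x.vel‖ ^ 2 := by
  have h1 : ‖x‖ ^ 2 = ‖x.t‖ ^ 2 + ‖WithLp.snd x‖ ^ 2 := WithLp.prod_norm_sq_eq_of_L2 x
  have h2 : ‖WithLp.snd x‖ ^ 2 = ‖x.sigElt‖ ^ 2 + ‖x.vel‖ ^ 2 :=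
    WithLp.prod_norm_sq_eq_of_L2 (WithLp.snd x)
  have h3 : ‖x.sigElt‖ ^ 2 = ‖x.sig‖ ^ 2 + ‖x.divSig‖ ^ 2 := WithLp.prod_norm_sq_eq_of_L2
    (x.sigElt : WithLp 2 (Lp (Tens n n) 2 (vol Ω) × Lp (Vec n) 2 (vol Ω)))
  rw [h1, h2, h3]
  ring

theorem norm_t_le (x : FlowSpace Ω) : ‖x.t‖ ≤ ‖x‖ :=
  le_of_sq_le_sq
    (by
      rw [norm_sq_flow]
      linarith [sq_nonneg (‖x.sig‖), sq_nonneg (‖x.divSig‖),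
        sq_nonneg (‖x.vel‖)])
    (norm_nonneg_flow _)

theorem norm_sig_le (x : FlowSpace Ω) : ‖x.sig‖ ≤ ‖x‖ :=
  le_of_sq_le_sq
    (by
      rw [norm_sq_flow]
      linarith [sq_nonneg (‖x.t‖), sq_nonneg (‖x.divSig‖),
        sq_nonneg (‖x.vel‖)])
    (norm_nonneg_flow _)

theorem norm_divSig_le (x : FlowSpace Ω) : ‖x.divSig‖ ≤ ‖x‖ :=
  le_of_sq_le_sq
    (by
      rw [norm_sq_flow]
      linarith [sq_nonneg (‖x.t‖), sq_nonneg (‖x.sig‖),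
        sq_nonneg (‖x.vel‖)])
    (norm_nonneg_flow _)

theorem norm_vel_le (x : FlowSpace Ω) : ‖x.vel‖ ≤ ‖x‖ :=
  le_of_sq_le_sq
    (by
      rw [norm_sq_flow]
      linarith [sq_nonneg (‖x.t‖), sq_nonneg (‖x.sig‖),
        sq_nonneg (‖x.divSig‖)])
    (norm_nonneg_flow _)

theorem norm_u_le_vel (x : FlowSpace Ω) : ‖x.u‖ ≤ ‖x.vel‖ := norm_fld_le (x.vel : H1 Ω n)

theorem norm_u_le (x : FlowSpace Ω) : ‖x.u‖ ≤ ‖x‖ := (norm_u_le_vel x).trans (norm_vel_le x)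

theorem norm_gradU_le (x : FlowSpace Ω) : ‖x.gradU‖ ≤ ‖x‖ :=
  (norm_grd_le (x.vel : H1 Ω n)).trans (norm_vel_le x)

end Components

/-- Cauchy–Schwarz, (a + κb)² ≤ (1 + κ²)(a² + b²), with room to spare. The factor is the one in r₀
and C_ST; it bounds the test functions r - κ₃τᵈ and v - κ₂ div τ. -/
theorem add_mul_le_sqrt_mul {a b κ N : ℝ} (hN : 0 ≤ N) (h : a ^ 2 + b ^ 2 ≤ N ^ 2) :
    a + κ * b ≤ √(2 + κ ^ 2) * N := by
  refine le_trans (Real.le_sqrt_of_sq_le (y := (2 + κ ^ 2) * N ^ 2) ?_) (le_of_eq ?_)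
  · nlinarith [sq_nonneg (κ * a - b), sq_nonneg κ, sq_nonneg a, sq_nonneg N,
      mul_le_mul_of_nonneg_left h (by positivity : 0 ≤ 1 + κ ^ 2)]
  · rw [Real.sqrt_mul (by positivity), Real.sqrt_sq hN]

/-! ### The forms as inner products -/

section Forms

variable {n : ℕ} {Ω : Set (Vec n)} (d : Data n)

/-- The action of `dev` on `L²`. -/
def devLp (Ω : Set (Vec n)) : Lp (Tens n n) 2 (vol Ω) →L[ℝ] Lp (Tens n n) 2 (vol Ω) :=
  (devL n).compLpL 2 (vol Ω)

theorem norm_devLp_le (f : Lp (Tens n n) 2 (vol Ω)) : ‖devLp Ω f‖ ≤ ‖f‖ := by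
  refine Lp.norm_le_norm_of_ae_le ?_
  filter_upwards [(devL n).coeFn_compLpL f] with x hx
  rw [devLp, hx, devL_apply]
  exact norm_dev_le _

/-- The map `y = (r, τ, v) ↦ r - κ₃ τᵈ`. -/
def strainTest (y : FlowSpace Ω) : Lp (Tens n n) 2 (vol Ω) := y.t - d.κ₃ • devLp Ω y.sig

theorem coeFn_strainTest (y : FlowSpace Ω) :
    strainTest d y =ᵐ[vol Ω] fun s => y.t s - d.κ₃ • dev (y.sig s) := by
  rw [strainTest]
  filter_upwards [Lp.coeFn_sub y.t (d.κ₃ • devLp Ω y.sig), Lp.coeFn_smul d.κ₃ (devLp Ω y.sig),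
    (devL n).coeFn_compLpL y.sig] with s h1 h2 h3
  rw [h1, Pi.sub_apply, h2, Pi.smul_apply, devLp, h3]
  rfl

theorem norm_strainTest_le (hκ : 0 ≤ d.κ₃) (y : FlowSpace Ω) :
    ‖strainTest d y‖ ≤ √(2 + d.κ₃ ^ 2) * ‖y‖ := by
  have h1 : ‖strainTest d y‖ ≤ ‖y.t‖ + d.κ₃ * ‖y.sig‖ := by
    rw [strainTest]
    refine (norm_sub_le _ _).trans (add_le_add_right ?_ _)
    rw [norm_smul, Real.norm_of_nonneg hκ]
    exact mul_le_mul_of_nonneg_left (norm_devLp_le _) hκ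
  refine h1.trans (add_mul_le_sqrt_mul (norm_nonneg_flow _) ?_)
  rw [norm_sq_flow]
  nlinarith [sq_nonneg (‖y.vel‖), sq_nonneg (‖y.divSig‖)]

/-- The map `y = (r, τ, v) ↦ v - κ₂ div τ`. -/
def forceTest (y : FlowSpace Ω) : Lp (Vec n) 2 (vol Ω) := y.u - d.κ₂ • y.divSig

theorem norm_forceTest_le (hκ : 0 ≤ d.κ₂) (y : FlowSpace Ω) :
    ‖forceTest d y‖ ≤ √(2 + d.κ₂ ^ 2) * ‖y‖ := by
  have h1 : ‖forceTest d y‖ ≤ ‖y.u‖ + d.κ₂ * ‖y.divSig‖ := by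
    rw [forceTest]
    refine (norm_sub_le _ _).trans (add_le_add_right ?_ _)
    rw [norm_smul, Real.norm_of_nonneg hκ]
  refine h1.trans (add_mul_le_sqrt_mul (norm_nonneg_flow _) ?_)
  rw [norm_sq_flow]
  have := norm_u_le_vel y
  nlinarith [sq_nonneg (‖y.t‖), sq_nonneg (‖y.sig‖), norm_nonneg y.u]

/-- The action of `symPart` on `L²`. -/
def symLp (Ω : Set (Vec n)) : Lp (Tens n n) 2 (vol Ω) →L[ℝ] Lp (Tens n n) 2 (vol Ω) :=
  (symL n).compLpL 2 (vol Ω)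

/-- The action of `skewPart` on `L²`. -/
def skewLp (Ω : Set (Vec n)) : Lp (Tens n n) 2 (vol Ω) →L[ℝ] Lp (Tens n n) 2 (vol Ω) :=
  (skewL n).compLpL 2 (vol Ω)

/-- The part of the form `A_φ` that does not depend on `φ`. -/
def formAConst (x y : FlowSpace Ω) : ℝ :=
  inner ℝ x.t (devLp Ω y.sig - d.κ₁ • symLp Ω y.gradU)
  - inner ℝ (devLp Ω x.sig) (strainTest d y)
  + (1 - d.κ₂ * d.γ) * inner ℝ x.u y.divSig
  - inner ℝ x.divSig y.u
  + inner ℝ (skewLp Ω x.gradU) y.sig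
  - inner ℝ x.sig (skewLp Ω y.gradU)
  + d.γ * inner ℝ x.u y.u
  + d.κ₂ * inner ℝ x.divSig y.divSig
  + d.κ₁ * inner ℝ (symLp Ω x.gradU) (symLp Ω y.gradU)

theorem formAConst_sub_left (x x' y : FlowSpace Ω) :
    formAConst d (x - x') y = formAConst d x y - formAConst d x' y := by
  simp only [formAConst, t_sub, sig_sub, divSig_sub, u_sub, gradU_sub, map_sub, inner_sub_left]
  ring

theorem abs_inner_le_of_le {V : Type*} [NormedAddCommGroup V] [InnerProductSpace ℝ V] {f g : V}
    {a b X Y : ℝ} (hf : ‖f‖ ≤ a * X) (hg : ‖g‖ ≤ b * Y) : |inner ℝ f g| ≤ a * b * (X * Y) := by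
  refine (abs_real_inner_le_norm f g).trans ((mul_le_mul hf hg (norm_nonneg _)
    ((norm_nonneg _).trans hf)).trans (le_of_eq ?_))
  ring

/-- A crude constant, one summand per term of the form, is enough: it enters only C* and none of the
smallness conditions. -/
theorem exists_abs_formAConst_le (Ω : Set (Vec n)) (hκ : 0 ≤ d.κ₃) :
    ∃ M, 0 ≤ M ∧ ∀ x y : FlowSpace Ω, |formAConst d x y| ≤ M * (‖x‖ * ‖y‖) := by
  let S := ‖symLp Ω‖
  let W := ‖skewLp Ω‖
  let R := √(2 + d.κ₃ ^ 2)
  refine ⟨1 * (1 + |d.κ₁| * S) + 1 * R + |1 - d.κ₂ * d.γ| * (1 * 1) + 1 * 1 + W * 1 + 1 * W +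
    |d.γ| * (1 * 1) + |d.κ₂| * (1 * 1) + |d.κ₁| * (S * S), by positivity, fun x y => ?_⟩
  have ht : ∀ z : FlowSpace Ω, ‖z.t‖ ≤ 1 * ‖z‖ := fun z => (norm_t_le z).trans_eq (one_mul _).symm
  have hs : ∀ z : FlowSpace Ω, ‖z.sig‖ ≤ 1 * ‖z‖ := fun z =>
    (norm_sig_le z).trans_eq (one_mul _).symm
  have hdev : ∀ z : FlowSpace Ω, ‖devLp Ω z.sig‖ ≤ 1 * ‖z‖ := fun z =>
    (norm_devLp_le _).trans (hs z)
  have hdiv : ∀ z : FlowSpace Ω, ‖z.divSig‖ ≤ 1 * ‖z‖ := fun z =>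
    (norm_divSig_le z).trans_eq (one_mul _).symm
  have hu : ∀ z : FlowSpace Ω, ‖z.u‖ ≤ 1 * ‖z‖ := fun z => (norm_u_le z).trans_eq (one_mul _).symm
  have hsym : ∀ z : FlowSpace Ω, ‖symLp Ω z.gradU‖ ≤ S * ‖z‖ := fun z =>
    ((symLp Ω).le_opNorm _).trans (mul_le_mul_of_nonneg_left (norm_gradU_le z) (norm_nonneg _))
  have hskew : ∀ z : FlowSpace Ω, ‖skewLp Ω z.gradU‖ ≤ W * ‖z‖ := fun z =>
    ((skewLp Ω).le_opNorm _).trans (mul_le_mul_of_nonneg_left (norm_gradU_le z) (norm_nonneg _))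
  have hds : ‖devLp Ω y.sig - d.κ₁ • symLp Ω y.gradU‖ ≤ (1 + |d.κ₁| * S) * ‖y‖ := by
    refine (norm_sub_le _ _).trans ?_
    rw [norm_smul, Real.norm_eq_abs, add_mul, mul_assoc]
    exact add_le_add (hdev y) (mul_le_mul_of_nonneg_left (hsym y) (abs_nonneg _))
  have h1 := abs_inner_le_of_le (ht x) hds
  have h2 := abs_inner_le_of_le (hdev x) (norm_strainTest_le d hκ y)
  have h3 := mul_le_mul_of_nonneg_left (abs_inner_le_of_le (hu x) (hdiv y))
    (abs_nonneg (1 - d.κ₂ * d.γ))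
  have h4 := abs_inner_le_of_le (hdiv x) (hu y)
  have h5 := abs_inner_le_of_le (hskew x) (hs y)
  have h6 := abs_inner_le_of_le (hs x) (hskew y)
  have h7 := mul_le_mul_of_nonneg_left (abs_inner_le_of_le (hu x) (hu y)) (abs_nonneg d.γ)
  have h8 := mul_le_mul_of_nonneg_left (abs_inner_le_of_le (hdiv x) (hdiv y)) (abs_nonneg d.κ₂)
  have h9 := mul_le_mul_of_nonneg_left (abs_inner_le_of_le (hsym x) (hsym y)) (abs_nonneg d.κ₁)
  rw [← abs_mul] at h3 h7 h8 h9
  rw [formAConst]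
  refine (abs_add_le _ _).trans (le_trans (add_le_add ((abs_add_le _ _).trans (add_le_add
    ((abs_add_le _ _).trans (add_le_add ((abs_sub _ _).trans (add_le_add ((abs_add_le _ _).trans
    (add_le_add ((abs_sub _ _).trans (add_le_add ((abs_add_le _ _).trans (add_le_add
    ((abs_sub _ _).trans (add_le_add h1 h2)) h3)) h4)) h5)) h6)) h7)) h8)) h9) (le_of_eq ?_))
  simp only [R]
  ring

variable {d}

theorem Data.Admissible.continuous_ν (hd : d.Admissible Ω) : Continuous d.ν := by
  have : LipschitzWith (Real.toNNReal d.Lν) d.ν := LipschitzWith.of_dist_le_mul fun a b => by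
    rw [Real.dist_eq, dist_eq_norm, Real.coe_toNNReal _ hd.Lν_pos.le]
    exact hd.ν_lip a b
  exact this.continuous

theorem Data.Admissible.κ₂_nonneg (hd : d.Admissible Ω) : 0 ≤ d.κ₂ := by
  obtain ⟨_, _, _, -, -, -, -, -, -, -, -, h, -⟩ := hd.κ_range
  exact h.le

theorem Data.Admissible.κ₃_nonneg (hd : d.Admissible Ω) : 0 ≤ d.κ₃ := by
  obtain ⟨_, _, _, -, -, -, -, -, -, -, -, -, -, h, -⟩ := hd.κ_range
  exact h.le

theorem Data.Admissible.abs_ν_le (hd : d.Admissible Ω) (a : Vec 2) : |d.ν a| ≤ d.ν₂ :=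
  abs_le.2 ⟨by linarith [(hd.ν_bounds a).1, hd.ν₁_pos, hd.ν₂_pos], (hd.ν_bounds a).2⟩

theorem memLp_ν (hd : d.Admissible Ω) (φ : H1 Ω 2) :
    MemLp (fun s => d.ν (fld φ s)) ⊤ (vol Ω) :=
  memLp_top_of_bound (hd.continuous_ν.comp_aestronglyMeasurable (Lp.aestronglyMeasurable _)) d.ν₂
    (Eventually.of_forall fun _ => hd.abs_ν_le _)

/-- The viscosity `ν(φ)` in `L^∞`. -/
def νLp (hd : d.Admissible Ω) (φ : H1 Ω 2) : Lp ℝ ⊤ (vol Ω) := (memLp_ν hd φ).toLp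

/-- The product `ν(φ) t` in `L²`. -/
def νSmul (hd : d.Admissible Ω) (φ : H1 Ω 2) (t : Lp (Tens n n) 2 (vol Ω)) :
    Lp (Tens n n) 2 (vol Ω) := νLp hd φ • t

theorem coeFn_νSmul (hd : d.Admissible Ω) (φ : H1 Ω 2) (t : Lp (Tens n n) 2 (vol Ω)) :
    νSmul hd φ t =ᵐ[vol Ω] fun s => d.ν (fld φ s) • t s := by
  filter_upwards [Lp.coeFn_lpSMul (r := 2) (νLp hd φ) t, (memLp_ν hd φ).coeFn_toLp] with s h1 h2
  rw [νSmul, h1, Pi.smul_apply', νLp, h2]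

theorem νSmul_sub (hd : d.Admissible Ω) (φ : H1 Ω 2) (t t' : Lp (Tens n n) 2 (vol Ω)) :
    νSmul hd φ (t - t') = νSmul hd φ t - νSmul hd φ t' := by
  rw [νSmul, sub_eq_add_neg, Lp.add_smul, Lp.smul_neg, ← sub_eq_add_neg]
  rfl

theorem norm_νSmul_le (hd : d.Admissible Ω) (φ : H1 Ω 2) (t : Lp (Tens n n) 2 (vol Ω)) :
    ‖νSmul hd φ t‖ ≤ d.ν₂ * ‖t‖ := by
  refine Lp.norm_le_mul_norm_of_ae_le_mul ?_
  filter_upwards [coeFn_νSmul hd φ t] with s h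
  rw [h, norm_smul]
  exact mul_le_mul_of_nonneg_right (hd.abs_ν_le _) (norm_nonneg _)

/-- Isolates the one term that depends on φ, so that differences in φ reduce to a single inner
product (`formA_sub_field`). As L² inner products, the terms are linear without separate
integrability checks. -/
theorem formA_eq (hd : d.Admissible Ω) (φ : H1 Ω 2) (x y : FlowSpace Ω) :
    formA d φ x y =
      2 * inner ℝ (νSmul hd φ x.t) (strainTest d y) + formAConst d x y := by
  simp only [formAConst, L2.inner_def]
  have hdev : ∀ f : Lp (Tens n n) 2 (vol Ω), devLp Ω f =ᵐ[vol Ω] fun s => dev (f s) :=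
    fun f => (devL n).coeFn_compLpL f
  have hsym : ∀ f : Lp (Tens n n) 2 (vol Ω),
      symLp Ω f =ᵐ[vol Ω] fun s => symPart (f s) :=
    fun f => (symL n).coeFn_compLpL f
  have hskew : ∀ f : Lp (Tens n n) 2 (vol Ω),
      skewLp Ω f =ᵐ[vol Ω] fun s => skewPart (f s) :=
    fun f => (skewL n).coeFn_compLpL f
  have e1 : ∫ s, inner ℝ (νSmul hd φ x.t s) (strainTest d y s) ∂(vol Ω) =
      ∫ s, d.ν (fld φ s) * inner ℝ (x.t s) (y.t s - d.κ₃ • dev (y.sig s)) ∂(vol Ω) := by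
    refine integral_congr_ae ?_
    filter_upwards [coeFn_νSmul hd φ x.t, coeFn_strainTest d y] with s h1 h2
    rw [h1, h2, real_inner_smul_left]
  have e2 : ∫ s, inner ℝ (x.t s)
      ((devLp Ω y.sig - d.κ₁ • symLp Ω y.gradU) s) ∂(vol Ω) =
      ∫ s, inner ℝ (x.t s) (dev (y.sig s) - d.κ₁ • symPart (y.gradU s)) ∂(vol Ω) := by
    refine integral_congr_ae ?_
    filter_upwards [hdev y.sig, hsym y.gradU, Lp.coeFn_sub (devLp Ω y.sig)
      (d.κ₁ • symLp Ω y.gradU),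
      Lp.coeFn_smul d.κ₁ (symLp Ω y.gradU)] with s h1 h2 h3 h4
    rw [h3, Pi.sub_apply, h4, Pi.smul_apply, h1, h2]
  have e3 : ∫ s, inner ℝ (devLp Ω x.sig s) (strainTest d y s) ∂(vol Ω) =
      ∫ s, inner ℝ (dev (x.sig s)) (y.t s - d.κ₃ • dev (y.sig s)) ∂(vol Ω) := by
    refine integral_congr_ae ?_
    filter_upwards [hdev x.sig, coeFn_strainTest d y] with s h1 h2
    rw [h1, h2]
  have e4 : ∫ s, inner ℝ (x.divSig s) (y.u s) ∂(vol Ω) =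
      ∫ s, inner ℝ (y.u s) (x.divSig s) ∂(vol Ω) :=
    integral_congr_ae (Eventually.of_forall fun s => real_inner_comm _ _)
  have e5 : ∫ s, inner ℝ (skewLp Ω x.gradU s) (y.sig s) ∂(vol Ω) =
      ∫ s, inner ℝ (skewPart (x.gradU s)) (y.sig s) ∂(vol Ω) := by
    refine integral_congr_ae ?_
    filter_upwards [hskew x.gradU] with s h1
    rw [h1]
  have e6 : ∫ s, inner ℝ (x.sig s) (skewLp Ω y.gradU s) ∂(vol Ω) =
      ∫ s, inner ℝ (x.sig s) (skewPart (y.gradU s)) ∂(vol Ω) := by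
    refine integral_congr_ae ?_
    filter_upwards [hskew y.gradU] with s h1
    rw [h1]
  have e7 : ∫ s, inner ℝ (symLp Ω x.gradU s)
      (symLp Ω y.gradU s) ∂(vol Ω) =
      ∫ s, inner ℝ (symPart (x.gradU s)) (symPart (y.gradU s)) ∂(vol Ω) := by
    refine integral_congr_ae ?_
    filter_upwards [hsym x.gradU, hsym y.gradU] with s h1 h2
    rw [h1, h2]
  rw [e1, e2, e3, e4, e5, e6, e7, formA]
  ring

theorem formA_sub_left (hd : d.Admissible Ω) (φ : H1 Ω 2) (x x' y : FlowSpace Ω) :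
    formA d φ (x - x') y = formA d φ x y - formA d φ x' y := by
  rw [formA_eq hd, formA_eq hd, formA_eq hd, t_sub, νSmul_sub, inner_sub_left, formAConst_sub_left]
  ring

theorem exists_abs_formA_le (hd : d.Admissible Ω) :
    ∃ M, 0 ≤ M ∧ ∀ (φ : H1 Ω 2) (x y : FlowSpace Ω), |formA d φ x y| ≤ M * (‖x‖ * ‖y‖) := by
  obtain ⟨M, hM, h⟩ := exists_abs_formAConst_le d Ω hd.κ₃_nonneg
  have hν := hd.ν₂_pos
  refine ⟨2 * (d.ν₂ * √(2 + d.κ₃ ^ 2)) + M, by positivity, fun φ x y => ?_⟩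
  have h1 := abs_inner_le_of_le ((norm_νSmul_le hd φ x.t).trans
    (mul_le_mul_of_nonneg_left (norm_t_le x) hν.le)) (norm_strainTest_le d hd.κ₃_nonneg y)
  rw [formA_eq hd]
  refine (abs_add_le _ _).trans ?_
  rw [abs_mul, abs_two]
  linarith [h x y]

theorem formA_sub_field (hd : d.Admissible Ω) (φ φ' : H1 Ω 2) (x y : FlowSpace Ω) :
    formA d φ x y - formA d φ' x y =
      2 * inner ℝ (νSmul hd φ x.t - νSmul hd φ' x.t) (strainTest d y) := by
  rw [formA_eq hd, formA_eq hd, inner_sub_left]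
  ring

/-! The functional `F_φ`. -/

/-- The map `φ ↦ (α · φ) g` on vectors. -/
def forceVec (d : Data n) : Vec 2 →L[ℝ] Vec n := (innerSL ℝ d.α).smulRight d.g

theorem functF_eq (φ : H1 Ω 2) (y : FlowSpace Ω) :
    functF d φ y = inner ℝ ((forceVec d).compLpL 2 (vol Ω) (fld φ)) (forceTest d y) := by
  rw [L2.inner_def, functF, forceTest]
  refine integral_congr_ae ?_
  filter_upwards [(forceVec d).coeFn_compLpL (fld φ), Lp.coeFn_sub y.u (d.κ₂ • y.divSig),
    Lp.coeFn_smul d.κ₂ y.divSig] with s h1 h2 h3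
  rw [h1, h2, Pi.sub_apply, h3, Pi.smul_apply]
  simp [forceVec, real_inner_smul_left]

theorem functF_sub (φ φ' : H1 Ω 2) (y : FlowSpace Ω) :
    functF d (φ - φ') y = functF d φ y - functF d φ' y := by
  rw [functF_eq, functF_eq, functF_eq, fld_sub, map_sub, inner_sub_left]

theorem abs_functF_le (hd : d.Admissible Ω) (φ : H1 Ω 2) (y : FlowSpace Ω) :
    |functF d φ y| ≤ ‖d.α‖ * ‖d.g‖ * ‖φ‖ * (√(2 + d.κ₂ ^ 2) * ‖y‖) := by
  rw [functF_eq]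
  have h1 : ‖forceVec d‖ ≤ ‖d.α‖ * ‖d.g‖ := by
    rw [forceVec, ContinuousLinearMap.norm_smulRight_apply, innerSL_apply_norm]
  refine (abs_real_inner_le_norm _ _).trans
    (mul_le_mul ?_ (norm_forceTest_le d hd.κ₂_nonneg y) (norm_nonneg _) (by positivity))
  exact ((forceVec d).norm_compLp_le (fld φ)).trans
    (mul_le_mul h1 (norm_fld_le φ) (norm_nonneg _) (by positivity))

/-! The form `C`. -/

theorem memLp_diffusion (hd : d.Admissible Ω) (f : Lp (Tens 2 n) 2 (vol Ω)) :
    MemLp (fun s => (WithLp.toLp 2 fun p => d.K p.1 s * f s p : Tens 2 n)) 2 (vol Ω) := by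
  obtain ⟨M, hM⟩ := hd.K_bdd
  have hcoord : ∀ p, AEStronglyMeasurable (fun s => d.K p.1 s * f s p) (vol Ω) := fun p =>
    (hd.K_meas p.1).aestronglyMeasurable.mul
      ((EuclideanSpace.proj (𝕜 := ℝ) p).continuous.comp_aestronglyMeasurable
        (Lp.aestronglyMeasurable f))
  have hmeas : AEStronglyMeasurable
      (fun s => (WithLp.toLp 2 fun p => d.K p.1 s * f s p : Tens 2 n)) (vol Ω) :=
    (PiLp.continuous_toLp 2 _).comp_aestronglyMeasurable
      (aemeasurable_pi_lambda _ fun p => (hcoord p).aemeasurable).aestronglyMeasurable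
  refine (Lp.memLp f).of_le_mul (c := M) hmeas ?_
  filter_upwards [ae_all_iff.2 hM] with s hs
  have hM0 : 0 ≤ M := (abs_nonneg _).trans (hs 0)
  refine le_of_sq_le_sq ?_ (by positivity)
  rw [mul_pow, EuclideanSpace.norm_sq_eq, EuclideanSpace.norm_sq_eq, Finset.mul_sum]
  refine Finset.sum_le_sum fun p _ => ?_
  rw [norm_mul, mul_pow]
  exact mul_le_mul_of_nonneg_right (pow_le_pow_left₀ (norm_nonneg _) (hs p.1) 2) (sq_nonneg _)

/-- The product `𝕂 f` in `L²`. -/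
def diffusion (hd : d.Admissible Ω) (f : Lp (Tens 2 n) 2 (vol Ω)) : Lp (Tens 2 n) 2 (vol Ω) :=
  (memLp_diffusion hd f).toLp

theorem coeFn_diffusion (hd : d.Admissible Ω) (f : Lp (Tens 2 n) 2 (vol Ω)) :
    ∀ᵐ s ∂(vol Ω), ∀ p, diffusion hd f s p = d.K p.1 s * f s p := by
  filter_upwards [(memLp_diffusion hd f).coeFn_toLp] with s h p
  rw [diffusion, h]

theorem diffusion_sub (hd : d.Admissible Ω) (f f' : Lp (Tens 2 n) 2 (vol Ω)) :
    diffusion hd (f - f') = diffusion hd f - diffusion hd f' := by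
  refine Lp.ext ?_
  filter_upwards [coeFn_diffusion hd (f - f'), coeFn_diffusion hd f, coeFn_diffusion hd f',
    Lp.coeFn_sub f f', Lp.coeFn_sub (diffusion hd f) (diffusion hd f')] with s h1 h2 h3 h4 h5
  ext p
  rw [h1, h4, h5, Pi.sub_apply, Pi.sub_apply, PiLp.sub_apply, PiLp.sub_apply, h2, h3, mul_sub]

theorem exists_norm_diffusion_le (hd : d.Admissible Ω) :
    ∃ M, 0 ≤ M ∧ ∀ f : Lp (Tens 2 n) 2 (vol Ω), ‖diffusion hd f‖ ≤ M * ‖f‖ := by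
  obtain ⟨M, hM⟩ := hd.K_bdd
  refine ⟨|M|, abs_nonneg M, fun f => Lp.norm_le_mul_norm_of_ae_le_mul ?_⟩
  filter_upwards [coeFn_diffusion hd f, ae_all_iff.2 hM] with s h hs
  refine le_of_sq_le_sq ?_ (by positivity)
  rw [mul_pow, EuclideanSpace.norm_sq_eq, EuclideanSpace.norm_sq_eq, Finset.mul_sum]
  refine Finset.sum_le_sum fun p _ => ?_
  rw [h, norm_mul, mul_pow]
  exact mul_le_mul_of_nonneg_right
    (pow_le_pow_left₀ (norm_nonneg _) ((hs p.1).trans (le_abs_self M)) 2) (sq_nonneg _)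

theorem formC_eq (hd : d.Admissible Ω) (χ ψ : H1 Ω 2) :
    formC d χ ψ = inner ℝ (diffusion hd (grd χ)) (grd ψ) := by
  rw [L2.inner_def, formC]
  refine integral_congr_ae ?_
  filter_upwards [coeFn_diffusion hd (grd χ)] with s h
  simp only [PiLp.inner_apply, Fintype.sum_prod_type, h, RCLike.inner_apply, conj_trivial]
  exact Finset.sum_congr rfl fun i _ => Finset.sum_congr rfl fun j _ => by ring

theorem formC_sub_left (hd : d.Admissible Ω) (χ χ' ψ : H1 Ω 2) :
    formC d (χ - χ') ψ = formC d χ ψ - formC d χ' ψ := by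
  rw [formC_eq hd, formC_eq hd, formC_eq hd, grd_sub, diffusion_sub, inner_sub_left]

theorem exists_abs_formC_le (hd : d.Admissible Ω) :
    ∃ M, 0 ≤ M ∧ ∀ χ ψ : H1 Ω 2, |formC d χ ψ| ≤ M * ‖χ‖ * ‖ψ‖ := by
  obtain ⟨M, hM, h⟩ := exists_norm_diffusion_le hd
  refine ⟨M, hM, fun χ ψ => ?_⟩
  rw [formC_eq hd]
  exact (abs_real_inner_le_norm _ _).trans (mul_le_mul ((h _).trans
    (mul_le_mul_of_nonneg_left (norm_grd_le χ) hM)) (norm_grd_le ψ) (norm_nonneg _) (by positivity))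

theorem le_formC_self (hd : d.Admissible Ω) (ψ : H1 Ω 2) :
    d.k₀ * ‖grd ψ‖ ^ 2 ≤ formC d ψ ψ := by
  rw [formC_eq hd, ← real_inner_self_eq_norm_sq, ← real_inner_smul_left, L2.inner_def, L2.inner_def]
  refine integral_mono_ae (L2.integrable_inner _ _) (L2.integrable_inner _ _) ?_
  filter_upwards [coeFn_diffusion hd (grd ψ), ae_all_iff.2 hd.K_pos,
    Lp.coeFn_smul d.k₀ (grd ψ)] with s h hs h2
  rw [h2, Pi.smul_apply, PiLp.inner_apply, PiLp.inner_apply]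
  refine Finset.sum_le_sum fun p _ => ?_
  rw [h, PiLp.smul_apply]
  simp only [RCLike.inner_apply, conj_trivial, smul_eq_mul]
  nlinarith [mul_le_mul_of_nonneg_right (hs p.1) (mul_self_nonneg (grd ψ s p))]

end Forms

/-! ### Least constants -/

/-- For 0 < b < ∞ one divides by b. The case b = 0 needs its own hypothesis, since S may be empty,
with infimum ∞, and ∞ · 0 = 0. -/
theorem le_sInf_mul_of_forall_le {S : Set ℝ≥0∞} {a b : ℝ≥0∞} (hS : ∀ C ∈ S, a ≤ C * b)
    (hb : b ≠ ⊤) (h0 : b = 0 → a = 0) : a ≤ sInf S * b := by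
  rcases eq_or_ne b 0 with hb0 | hb0
  · rw [h0 hb0]
    exact zero_le
  · rw [← ENNReal.div_le_iff hb0 hb]
    exact le_sInf fun C hC => (ENNReal.div_le_iff hb0 hb).2 (hS C hC)

section Embedding

variable {n : ℕ} {Ω : Set (Vec n)}

theorem eLpNorm_fld_eq_zero {m : ℕ} {v : H1 Ω m} (hv : ‖v‖ = 0) (p : ℝ≥0∞) :
    eLpNorm (fld v) p (vol Ω) = 0 := by
  have h : ‖fld v‖ = 0 := le_antisymm ((norm_fld_le v).trans_eq hv) (norm_nonneg _)
  rw [norm_eq_zero] at h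
  rw [h, eLpNorm_congr_ae (Lp.coeFn_zero (Vec m) 2 (vol Ω)), eLpNorm_zero]

theorem eLpNorm_four_sq_le (v : H1 Ω n) :
    eLpNorm (fld v) 4 (vol Ω) ^ 2 ≤ c₁ Ω * ENNReal.ofReal (‖v‖ ^ 2) := by
  refine le_sInf_mul_of_forall_le (fun C hC => hC v) ENNReal.ofReal_ne_top fun h => ?_
  have : ‖v‖ = 0 := by simpa using le_antisymm (ENNReal.ofReal_eq_zero.1 h) (sq_nonneg _)
  rw [eLpNorm_fld_eq_zero this, zero_pow two_ne_zero]

/-- Extension of a vector by zero components. -/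
def padVec (m k : ℕ) : Vec m →L[ℝ] Vec (m + k) :=
  LinearMap.toContinuousLinearMap
    { toFun := fun v => WithLp.toLp 2 (Fin.append v 0)
      map_add' := fun v w => by
        ext i
        refine Fin.addCases (fun i => ?_) (fun i => ?_) i <;> simp
      map_smul' := fun c v => by
        ext i
        refine Fin.addCases (fun i => ?_) (fun i => ?_) i <;> simp }

/-- Extension of a tensor by zero rows. -/
def padTens (m k n : ℕ) : Tens m n →L[ℝ] Tens (m + k) n :=
  LinearMap.toContinuousLinearMap
    { toFun := fun G => WithLp.toLp 2 fun p => Fin.append (fun i => G (i, p.2)) 0 p.1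
      map_add' := fun v w => by
        ext ⟨i, j⟩
        refine Fin.addCases (fun i => ?_) (fun i => ?_) i <;> simp
      map_smul' := fun c v => by
        ext ⟨i, j⟩
        refine Fin.addCases (fun i => ?_) (fun i => ?_) i <;> simp }

theorem padVec_apply {m k : ℕ} (v : Vec m) (i : Fin (m + k)) :
    padVec m k v i = Fin.append v 0 i := rfl

theorem padTens_apply {m k n : ℕ} (G : Tens m n) (i : Fin (m + k)) (j : Fin n) :
    padTens m k n G (i, j) = Fin.append (fun i => G (i, j)) 0 i := rfl

theorem norm_padVec {m k : ℕ} (v : Vec m) : ‖padVec m k v‖ = ‖v‖ := by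
  refine (sq_eq_sq₀ (norm_nonneg _) (norm_nonneg _)).1 ?_
  rw [EuclideanSpace.norm_sq_eq, EuclideanSpace.norm_sq_eq, Fin.sum_univ_add]
  simp [padVec_apply]

theorem norm_padTens {m k n : ℕ} (G : Tens m n) : ‖padTens m k n G‖ = ‖G‖ := by
  refine (sq_eq_sq₀ (norm_nonneg _) (norm_nonneg _)).1 ?_
  rw [EuclideanSpace.norm_sq_eq, EuclideanSpace.norm_sq_eq, Fintype.sum_prod_type,
    Fintype.sum_prod_type, Fin.sum_univ_add]
  simp [padTens_apply]

/-- Extension of an `H¹` field by zero components. -/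
theorem exists_pad {m k : ℕ} (v : H1 Ω m) :
    ∃ v' : H1 Ω (m + k), (fld v' =ᵐ[vol Ω] fun s => padVec m k (fld v s)) ∧ ‖v'‖ = ‖v‖ := by
  have h1 := (padVec m k).coeFn_compLp' (fld v)
  have h2 := (padTens m k n).coeFn_compLp' (grd v)
  let z : WithLp 2 (Lp (Vec (m + k)) 2 (vol Ω) × Lp (Tens (m + k) n) 2 (vol Ω)) :=
    WithLp.toLp 2 ((padVec m k).compLp (fld v), (padTens m k n).compLp (grd v))
  have hz : z ∈ H1 Ω (m + k) := by
    intro η hη i j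
    have e1 : ∫ x, z.fst x i * pderiv j η x ∂(vol Ω) =
        ∫ x, Fin.append (fld v x) 0 i * pderiv j η x ∂(vol Ω) := by
      refine integral_congr_ae ?_
      filter_upwards [h1] with x hx
      have : z.fst x = padVec m k (fld v x) := hx
      rw [this, padVec_apply]
    have e2 : ∫ x, z.snd x (i, j) * η x ∂(vol Ω) =
        ∫ x, Fin.append (fun i => grd v x (i, j)) 0 i * η x ∂(vol Ω) := by
      refine integral_congr_ae ?_
      filter_upwards [h2] with x hx
      have : z.snd x = padTens m k n (grd v x) := hx
      rw [this, padTens_apply]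
    rw [e1, e2]
    refine Fin.addCases (fun i => ?_) (fun i => ?_) i
    · simp only [Fin.append_left]
      exact v.2 η hη i j
    · simp
  refine ⟨⟨z, hz⟩, h1, ?_⟩
  refine (sq_eq_sq₀ (norm_nonneg _) (norm_nonneg _)).1 ?_
  rw [norm_sq_H1, norm_sq_H1]
  have n1 : ‖(padVec m k).compLp (fld v)‖ = ‖fld v‖ := by
    refine le_antisymm (Lp.norm_le_norm_of_ae_le ?_) (Lp.norm_le_norm_of_ae_le ?_) <;>
    · filter_upwards [h1] with x hx
      rw [hx, norm_padVec]
  have n2 : ‖(padTens m k n).compLp (grd v)‖ = ‖grd v‖ := by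
    refine le_antisymm (Lp.norm_le_norm_of_ae_le ?_) (Lp.norm_le_norm_of_ae_le ?_) <;>
    · filter_upwards [h2] with x hx
      rw [hx, norm_padTens]
  have e1 : fld (⟨z, hz⟩ : H1 Ω (m + k)) = (padVec m k).compLp (fld v) := rfl
  have e2 : grd (⟨z, hz⟩ : H1 Ω (m + k)) = (padTens m k n).compLp (grd v) := rfl
  rw [e1, e2, n1, n2]

/-- The `L⁴` bound for `H¹` fields with at most `n` components. -/
theorem eLpNorm_four_le {m : ℕ} (hm : m ≤ n) (hc : c₁ Ω ≠ ⊤) (v : H1 Ω m) :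
    eLpNorm (fld v) 4 (vol Ω) ≤ ENNReal.ofReal (√(c₁ Ω).toReal * ‖v‖) := by
  -- c₁ refers to fields with n components, whereas the temperature-concentration field has two;
  -- padding with zero components changes neither norm.
  obtain ⟨v', hv', hn⟩ : ∃ v' : H1 Ω n, (∀ᵐ s ∂(vol Ω), ‖fld v s‖ = ‖fld v' s‖) ∧ ‖v'‖ = ‖v‖ := by
    obtain ⟨k, rfl⟩ := Nat.exists_eq_add_of_le hm
    obtain ⟨v', hv', hn⟩ := exists_pad (k := k) v
    refine ⟨v', ?_, hn⟩
    filter_upwards [hv'] with s hs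
    rw [hs, norm_padVec]
  rw [eLpNorm_congr_norm_ae hv', ← hn]
  have h := eLpNorm_four_sq_le v'
  rw [← ENNReal.ofReal_toReal hc, ← ENNReal.ofReal_mul ENNReal.toReal_nonneg,
    ← Real.sq_sqrt (ENNReal.toReal_nonneg (a := c₁ Ω)), ← mul_pow,
    ENNReal.ofReal_pow (by positivity)] at h
  exact (ENNReal.pow_le_pow_left_iff two_ne_zero).1 h

theorem memLp_four {m : ℕ} (hm : m ≤ n) (hc : c₁ Ω ≠ ⊤) (v : H1 Ω m) :
    MemLp (fld v) 4 (vol Ω) :=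
  ⟨Lp.aestronglyMeasurable _, (eLpNorm_four_le hm hc v).trans_lt ENNReal.ofReal_lt_top⟩

/-- An `H¹` field as an element of `L⁴`. -/
def toL4 {m : ℕ} (hm : m ≤ n) (hc : c₁ Ω ≠ ⊤) (v : H1 Ω m) : Lp (Vec m) 4 (vol Ω) :=
  (memLp_four hm hc v).toLp

theorem coeFn_toL4 {m : ℕ} (hm : m ≤ n) (hc : c₁ Ω ≠ ⊤) (v : H1 Ω m) :
    toL4 hm hc v =ᵐ[vol Ω] fld v := (memLp_four hm hc v).coeFn_toLp

theorem toL4_sub {m : ℕ} (hm : m ≤ n) (hc : c₁ Ω ≠ ⊤) (v v' : H1 Ω m) :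
    toL4 hm hc (v - v') = toL4 hm hc v - toL4 hm hc v' := by
  refine Lp.ext ?_
  filter_upwards [coeFn_toL4 hm hc v, coeFn_toL4 hm hc v', coeFn_toL4 hm hc (v - v'),
    coeFn_fld_sub v v', Lp.coeFn_sub (toL4 hm hc v) (toL4 hm hc v')] with s h1 h2 h3 h4 h5
  rw [h3, h4, h5, Pi.sub_apply, h1, h2]

theorem norm_toL4_le {m : ℕ} (hm : m ≤ n) (hc : c₁ Ω ≠ ⊤) (v : H1 Ω m) :
    ‖toL4 hm hc v‖ ≤ √(c₁ Ω).toReal * ‖v‖ := by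
  rw [toL4, Lp.norm_toLp]
  exact ENNReal.toReal_le_of_le_ofReal (by positivity) (eLpNorm_four_le hm hc v)

/-- The dyadic product of two `H¹` fields, in `L²`. -/
def outerLp {m : ℕ} (hm : m ≤ n) (hc : c₁ Ω ≠ ⊤) (v : H1 Ω m) (w : H1 Ω n) :
    Lp (Tens m n) 2 (vol Ω) :=
  (outerL m n).holderₗ (vol Ω) 4 4 2 (toL4 hm hc v) (toL4 le_rfl hc w)

theorem coeFn_outerLp {m : ℕ} (hm : m ≤ n) (hc : c₁ Ω ≠ ⊤) (v : H1 Ω m) (w : H1 Ω n) :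
    outerLp hm hc v w =ᵐ[vol Ω] fun s => outerL m n (fld v s) (fld w s) := by
  filter_upwards [(outerL m n).coeFn_holder (r := 2) (toL4 hm hc v) (toL4 le_rfl hc w),
    coeFn_toL4 hm hc v, coeFn_toL4 le_rfl hc w] with s h1 h2 h3
  rw [outerLp, ContinuousLinearMap.holderₗ_apply_apply, h1, h2, h3]

theorem norm_outerLp_le {m : ℕ} (hm : m ≤ n) (hc : c₁ Ω ≠ ⊤) (v : H1 Ω m) (w : H1 Ω n) :
    ‖outerLp hm hc v w‖ ≤ (c₁ Ω).toReal * ‖v‖ * ‖w‖ := by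
  refine ((outerL m n).norm_holder_apply_apply_le _ _).trans ?_
  have h1 := norm_toL4_le hm hc v
  have h2 := norm_toL4_le le_rfl hc w
  calc ‖outerL m n‖ * ‖toL4 hm hc v‖ * ‖toL4 le_rfl hc w‖
      ≤ 1 * (√(c₁ Ω).toReal * ‖v‖) * (√(c₁ Ω).toReal * ‖w‖) := by
        refine mul_le_mul (mul_le_mul (norm_outerL_le m n) h1 ENNReal.toReal_nonneg zero_le_one) h2
          ENNReal.toReal_nonneg (by positivity)
    _ = (√(c₁ Ω).toReal) ^ 2 * ‖v‖ * ‖w‖ := by ring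
    _ = (c₁ Ω).toReal * ‖v‖ * ‖w‖ := by rw [Real.sq_sqrt ENNReal.toReal_nonneg]

theorem outerLp_sub_left {m : ℕ} (hm : m ≤ n) (hc : c₁ Ω ≠ ⊤) (v v' : H1 Ω m) (w : H1 Ω n) :
    outerLp hm hc (v - v') w = outerLp hm hc v w - outerLp hm hc v' w := by
  simp only [outerLp, toL4_sub, map_sub, LinearMap.sub_apply]

theorem outerLp_sub_right {m : ℕ} (hm : m ≤ n) (hc : c₁ Ω ≠ ⊤) (v : H1 Ω m) (w w' : H1 Ω n) :
    outerLp hm hc v (w - w') = outerLp hm hc v w - outerLp hm hc v w' := by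
  simp only [outerLp, toL4_sub, map_sub]

end Embedding

/-! ### The convective forms -/

section Convection

variable {n : ℕ} {Ω : Set (Vec n)} {d : Data n}

/-- Finiteness of c₁ puts u ⊗ w in L². The sign appears because B is tested with κ₃τᵈ - r. -/
theorem formB_eq (hc : c₁ Ω ≠ ⊤) (w : H10 Ω) (x y : FlowSpace Ω) :
    formB d w x y =
      -inner ℝ (devLp Ω (outerLp le_rfl hc (x.vel : H1 Ω n) (w : H1 Ω n))) (strainTest d y) := by
  rw [L2.inner_def, formB, ← integral_neg]
  refine integral_congr_ae ?_
  filter_upwards [(devL n).coeFn_compLpL (outerLp le_rfl hc (x.vel : H1 Ω n) (w : H1 Ω n)),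
    coeFn_outerLp le_rfl hc (x.vel : H1 Ω n) (w : H1 Ω n), coeFn_strainTest d y] with s h1 h2 h3
  rw [devLp, h1, h2, h3, outerL_eq_outer, devL_apply, ← inner_neg_right, neg_sub]
  rfl

theorem formB_sub_left (hc : c₁ Ω ≠ ⊤) (w : H10 Ω) (x x' y : FlowSpace Ω) :
    formB d w (x - x') y = formB d w x y - formB d w x' y := by
  rw [formB_eq hc, formB_eq hc, formB_eq hc, vel_sub, Submodule.coe_sub, outerLp_sub_left,
    map_sub, inner_sub_left]
  ring

theorem formB_sub_field (hc : c₁ Ω ≠ ⊤) (w w' : H10 Ω) (x y : FlowSpace Ω) :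
    formB d (w - w') x y = formB d w x y - formB d w' x y := by
  rw [formB_eq hc, formB_eq hc, formB_eq hc, Submodule.coe_sub, outerLp_sub_right,
    map_sub, inner_sub_left]
  ring

theorem abs_formB_le (hd : d.Admissible Ω) (hc : c₁ Ω ≠ ⊤) (w : H10 Ω) (x y : FlowSpace Ω) :
    |formB d w x y| ≤ (c₁ Ω).toReal * √(2 + d.κ₃ ^ 2) * ‖w‖ * ‖x‖ * ‖y‖ := by
  rw [formB_eq hc, abs_neg]
  have h1 : ‖devLp Ω (outerLp le_rfl hc (x.vel : H1 Ω n) (w : H1 Ω n))‖ ≤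
      (c₁ Ω).toReal * ‖w‖ * ‖x‖ := by
    refine (norm_devLp_le _).trans ((norm_outerLp_le _ _ _ _).trans ?_)
    have e : ‖(w : H1 Ω n)‖ = ‖w‖ := rfl
    have e' : ‖(x.vel : H1 Ω n)‖ ≤ ‖x‖ := norm_vel_le x
    rw [e, mul_right_comm]
    exact mul_le_mul_of_nonneg_left e' (mul_nonneg ENNReal.toReal_nonneg (norm_nonneg w))
  refine (abs_inner_le_of_le h1 (norm_strainTest_le d hd.κ₃_nonneg y)).trans (le_of_eq ?_)
  ring

/-- Uses (∇φ)w · ψ = ∇φ : (ψ ⊗ w), which leaves ∇φ in L² and groups the two L⁴ factors. -/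
theorem functG_eq (hn : 2 ≤ n) (hc : c₁ Ω ≠ ⊤) (w : H10 Ω) (φ ψ : H1 Ω 2) :
    functG w φ ψ = -inner ℝ (grd φ) (outerLp hn hc ψ (w : H1 Ω n)) := by
  rw [L2.inner_def, functG]
  congr 1
  refine integral_congr_ae ?_
  filter_upwards [coeFn_outerLp hn hc ψ (w : H1 Ω n)] with s h
  rw [h, inner_tensMul]

theorem functG_sub_right (hn : 2 ≤ n) (hc : c₁ Ω ≠ ⊤) (w : H10 Ω) (φ φ' ψ : H1 Ω 2) :
    functG w (φ - φ') ψ = functG w φ ψ - functG w φ' ψ := by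
  rw [functG_eq hn hc, functG_eq hn hc, functG_eq hn hc, grd_sub, inner_sub_left]
  ring

theorem functG_sub_left (hn : 2 ≤ n) (hc : c₁ Ω ≠ ⊤) (w w' : H10 Ω) (φ ψ : H1 Ω 2) :
    functG (w - w') φ ψ = functG w φ ψ - functG w' φ ψ := by
  rw [functG_eq hn hc, functG_eq hn hc, functG_eq hn hc, Submodule.coe_sub, outerLp_sub_right,
    inner_sub_right]
  ring

theorem abs_functG_le (hn : 2 ≤ n) (hc : c₁ Ω ≠ ⊤) (w : H10 Ω) (φ ψ : H1 Ω 2) :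
    |functG w φ ψ| ≤ (c₁ Ω).toReal * ‖w‖ * ‖φ‖ * ‖ψ‖ := by
  rw [functG_eq hn hc, abs_neg]
  refine (abs_real_inner_le_norm _ _).trans ((mul_le_mul (norm_grd_le φ)
    (norm_outerLp_le hn hc ψ (w : H1 Ω n)) (norm_nonneg _) (norm_nonneg _)).trans (le_of_eq ?_))
  have e : ‖(w : H1 Ω n)‖ = ‖w‖ := rfl
  rw [e]
  ring

end Convection

/-! ### Dependence of the viscous term on the temperature -/

section Viscous

variable {n : ℕ} {Ω : Set (Vec n)} {d : Data n}

/-- The H^ε norm contains the L² norm. Needed for the degenerate case of the least constant C_ε. -/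
theorem fracNorm_eq_zero {ε : ℝ} {t : Lp (Tens n n) 2 (vol Ω)} (h : fracNorm ε t = 0) : t = 0 := by
  rw [fracNorm, ENNReal.rpow_eq_zero_iff_of_pos (by norm_num), add_eq_zero] at h
  have h1 := eq_zero_of_pow_eq_zero h.1
  rwa [eLpNorm_eq_zero_iff (Lp.aestronglyMeasurable _) two_ne_zero, ← Lp.eq_zero_iff_ae_eq_zero]
    at h1

theorem eLpNorm_le_Cε_mul {ε : ℝ} {t : Lp (Tens n n) 2 (vol Ω)} (ht : fracNorm ε t < ⊤) :
    eLpNorm t (ENNReal.ofReal (2 * n / (n - 2 * ε))) (vol Ω) ≤ Cε Ω ε * fracNorm ε t := by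
  refine le_sInf_mul_of_forall_le (fun C hC => hC t ht) ht.ne fun h => ?_
  rw [fracNorm_eq_zero h, eLpNorm_congr_ae (Lp.coeFn_zero (Tens n n) 2 (vol Ω)), eLpNorm_zero]

theorem eLpNorm_le_Cεt_mul (ε : ℝ) (φ : H1 Ω 2) :
    eLpNorm (fld φ) (ENNReal.ofReal (n / ε)) (vol Ω) ≤ Cεt Ω ε * ENNReal.ofReal ‖φ‖ := by
  refine le_sInf_mul_of_forall_le (fun C hC => hC φ) ENNReal.ofReal_ne_top fun h => ?_
  exact eLpNorm_fld_eq_zero (le_antisymm (ENNReal.ofReal_eq_zero.1 h) (norm_nonneg _)) _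

theorem holderTriple_of_pos {a ε : ℝ} (hε : 0 < ε) (ha : 2 * ε < a) :
    ENNReal.HolderTriple (ENNReal.ofReal (a / ε)) (ENNReal.ofReal (2 * a / (a - 2 * ε))) 2 where
  inv_add_inv_eq_inv := by
    have ha0 : 0 < a := by linarith
    have h1 : 0 < a - 2 * ε := by linarith
    rw [← ENNReal.ofReal_inv_of_pos (by positivity), ← ENNReal.ofReal_inv_of_pos (by positivity),
      ← ENNReal.ofReal_add (by positivity) (by positivity)]
    have : (a / ε)⁻¹ + (2 * a / (a - 2 * ε))⁻¹ = 2⁻¹ := by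
      field_simp
      ring
    rw [this, ENNReal.ofReal_inv_of_pos two_pos, ENNReal.ofReal_ofNat]

/-- Pointwise |ν(φ) - ν(φ')| ≤ L_ν|φ - φ'|, followed by Hölder with ε/n + (n - 2ε)/(2n) = 1/2 and
the two Sobolev embeddings. The extra integrability of t is what lets φ - φ' be measured in a norm
weaker than L^∞. -/
theorem enorm_νSmul_sub_le (hd : d.Admissible Ω) {ε : ℝ} (hε : 0 < ε) (hεn : 2 * ε < n)
    (φ φ' : H1 Ω 2) {t : Lp (Tens n n) 2 (vol Ω)} (ht : fracNorm ε t < ⊤) :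
    ‖νSmul hd φ t - νSmul hd φ' t‖ₑ ≤
      ENNReal.ofReal d.Lν * (Cεt Ω ε * ENNReal.ofReal ‖φ - φ'‖) * (Cε Ω ε * fracNorm ε t) := by
  have := holderTriple_of_pos (a := n) hε hεn
  have h1 : ⇑(νSmul hd φ t - νSmul hd φ' t) =ᵐ[vol Ω]
      (fun s => d.ν (fld φ s) - d.ν (fld φ' s)) • ⇑t := by
    filter_upwards [Lp.coeFn_sub (νSmul hd φ t) (νSmul hd φ' t), coeFn_νSmul hd φ t,
      coeFn_νSmul hd φ' t] with s h1 h2 h3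
    rw [h1, Pi.sub_apply, h2, h3, Pi.smul_apply', sub_smul]
  have hmeas : ∀ χ : H1 Ω 2, AEStronglyMeasurable (fun s => d.ν (fld χ s)) (vol Ω) := fun χ =>
    hd.continuous_ν.comp_aestronglyMeasurable (Lp.aestronglyMeasurable _)
  rw [Lp.enorm_def, eLpNorm_congr_ae h1]
  refine (eLpNorm_smul_le_mul_eLpNorm (p := ENNReal.ofReal (n / ε))
    (q := ENNReal.ofReal (2 * n / (n - 2 * ε))) (Lp.aestronglyMeasurable t)
    ((hmeas φ).sub (hmeas φ'))).trans (mul_le_mul' ?_ (eLpNorm_le_Cε_mul ht))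
  refine le_trans ?_ (mul_le_mul_right (eLpNorm_le_Cεt_mul ε (φ - φ')) _)
  refine eLpNorm_le_mul_eLpNorm_of_ae_le_mul ?_ _
  filter_upwards [coeFn_fld_sub φ φ'] with s h
  rw [h]
  exact hd.ν_lip _ _

end Viscous

/-! ### Consequences of the smallness assumptions -/

section Constants

variable {n : ℕ} {Ω ΓD : Set (Vec n)} {d : Data n}

/-- Integration by parts against the constant 1. It shows that constants have zero weak gradient. -/
theorem integral_pderiv_eq_zero {η : Vec n → ℝ} (hη : IsTest Ω η) (j : Fin n) :
    ∫ x, pderiv j η x ∂(vol Ω) = 0 := by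
  rw [setIntegral_eq_integral_of_forall_compl_eq_zero fun x hx => ?_]
  · have h_integ : Integrable (pderiv j η) (volume : Measure (Vec n)) :=
      (hη.continuous_pderiv j).integrable_of_hasCompactSupport (hη.compact_pderiv j)
    have hη' : Integrable η (volume : Measure (Vec n)) :=
      hη.smooth.continuous.integrable_of_hasCompactSupport hη.compact
    have h := integral_mul_fderiv_eq_neg_fderiv_mul_of_integrable
      (μ := (volume : Measure (Vec n))) (f := fun _ : Vec n => (1 : ℝ)) (g := η)
      (v := EuclideanSpace.single j 1) (by simp)
      (by simp only [one_mul]; exact h_integ) (by simp only [one_mul]; exact hη')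
      (fun _ _ => differentiableAt_const _)
      (fun x _ => (hη.smooth.differentiable (by simp)).differentiableAt)
    simpa [pderiv] using h
  · have : x ∉ tsupport (fderiv ℝ η) := fun h => hx (hη.supp (tsupport_fderiv_subset ℝ h))
    rw [pderiv, image_eq_zero_of_notMem_tsupport this]
    rfl

/-- A nonzero constant field lies in H¹(Ω) and has positive L⁴ norm. -/
theorem c₁_ne_zero (hn : 0 < n) (hΩ : IsPolyhedralDomain Ω) : c₁ Ω ≠ 0 := by
  have hfin : IsFiniteMeasure (vol Ω) :=
    ⟨by rw [Measure.restrict_apply_univ]; exact hΩ.bounded.measure_lt_top⟩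
  have hvol : volume Ω ≠ 0 := (hΩ.isOpen.measure_pos volume hΩ.connected.nonempty).ne'
  have hne : vol Ω ≠ 0 := by rwa [Ne, Measure.restrict_eq_zero]
  let c : Vec n := EuclideanSpace.single ⟨0, hn⟩ 1
  have hc : c ≠ 0 := by simp [c]
  have hae : (Lp.const 2 (vol Ω) c : Lp (Vec n) 2 (vol Ω)) =ᵐ[vol Ω] fun _ => c :=
    Lp.coeFn_const 2 (vol Ω) c
  let z : WithLp 2 (Lp (Vec n) 2 (vol Ω) × Lp (Tens n n) 2 (vol Ω)) :=
    WithLp.toLp 2 (Lp.const 2 (vol Ω) c, 0)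
  have hz : z ∈ H1 Ω n := by
    intro η hη i j
    have e1 : ∫ x, z.fst x i * pderiv j η x ∂(vol Ω) = ∫ x, c i * pderiv j η x ∂(vol Ω) := by
      refine integral_congr_ae ?_
      filter_upwards [hae] with x hx
      have : z.fst x = c := hx
      rw [this]
    have e2 : ∫ x, z.snd x (i, j) * η x ∂(vol Ω) = ∫ _, (0 : ℝ) ∂(vol Ω) := by
      refine integral_congr_ae ?_
      filter_upwards [Lp.coeFn_zero (Tens n n) 2 (vol Ω)] with x hx
      have : z.snd x = 0 := hx
      rw [this, PiLp.zero_apply, zero_mul]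
    rw [e1, e2, integral_const_mul, integral_pderiv_eq_zero hη, mul_zero, integral_zero, neg_zero]
  intro h0
  have h1 := eLpNorm_four_sq_le (⟨z, hz⟩ : H1 Ω n)
  rw [h0, zero_mul, nonpos_iff_eq_zero] at h1
  have h2 := eq_zero_of_pow_eq_zero h1
  have h3 : fld (⟨z, hz⟩ : H1 Ω n) =ᵐ[vol Ω] fun _ => c := hae
  rw [eLpNorm_congr_ae h3, eLpNorm_const c (by norm_num) hne] at h2
  simp [hc, hvol, hΩ.bounded.measure_lt_top.ne] at h2

/-- Otherwise the numerator of r₀ is 0 or its denominator is ∞, and r₀ = 0. -/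
theorem pos_and_c₁_ne_top_of_lt_r₀ {r : ℝ} (h : ENNReal.ofReal r < r₀ Ω d) :
    0 < αΩ Ω d ∧ c₁ Ω ≠ ⊤ := by
  refine ⟨?_, ?_⟩
  · by_contra hα
    rw [r₀, ENNReal.ofReal_of_nonpos (not_lt.1 hα), ENNReal.zero_div] at h
    exact not_lt_zero h
  · intro hc
    have h3 : root₃ d ≠ 0 := by
      rw [root₃, Ne, ENNReal.ofReal_eq_zero, not_le]
      positivity
    rw [r₀, hc, ENNReal.mul_top two_ne_zero, ENNReal.top_mul h3, ENNReal.div_top] at h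
    exact not_lt_zero h

/-- The smallness of `r` in terms of real numbers. -/
theorem mul_le_half_αΩ {r : ℝ} (hr : 0 < r) (h : ENNReal.ofReal r < r₀ Ω d) :
    (c₁ Ω).toReal * √(2 + d.κ₃ ^ 2) * r ≤ αΩ Ω d / 2 := by
  obtain ⟨hα, hc⟩ := pos_and_c₁_ne_top_of_lt_r₀ h
  have h1 : ENNReal.ofReal r * (2 * c₁ Ω * root₃ d) ≤ ENNReal.ofReal (αΩ Ω d) :=
    ENNReal.mul_le_of_le_div h.le
  have h2 := ENNReal.toReal_mono ENNReal.ofReal_ne_top h1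
  rw [ENNReal.toReal_ofReal hα.le, ENNReal.toReal_mul, ENNReal.toReal_mul, ENNReal.toReal_mul,
    root₃, ENNReal.toReal_ofReal hr.le, ENNReal.toReal_ofReal (Real.sqrt_nonneg _),
    ENNReal.toReal_ofNat] at h2
  linarith

/-- The supremum is attained, because every quotient A_φ(x, x)/‖x‖² bounds the set from above.
Positivity of α(Ω) rules out the empty set, whose real supremum is 0 by convention. -/
theorem αΩ_mul_le_formA (hα : 0 < αΩ Ω d) (φ : H1 Ω 2) (x : FlowSpace Ω) :
    αΩ Ω d * ‖x‖ ^ 2 ≤ formA d φ x x := by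
  have hne : {a : ℝ | ∀ (φ : H1 Ω 2) (x : FlowSpace Ω), a * ‖x‖ ^ 2 ≤ formA d φ x x}.Nonempty := by
    by_contra hne
    rw [Set.not_nonempty_iff_eq_empty] at hne
    rw [αΩ, hne, Real.sSup_empty] at hα
    exact lt_irrefl _ hα
  rcases (sq_nonneg (‖x‖)).eq_or_lt with h0 | h0
  · obtain ⟨a, ha⟩ := hne
    have := ha φ x
    rw [← h0, mul_zero] at this ⊢
    exact this
  · rw [← le_div_iff₀ h0]
    exact csSup_le hne fun a ha => (le_div_iff₀ h0).2 (ha φ x)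

/-- For ‖w‖₁ ≤ r < r₀ the convective form uses up at most half of the ellipticity of A_φ. -/
theorem le_formA_add_formB (hd : d.Admissible Ω) {r : ℝ} (hr : 0 < r)
    (h : ENNReal.ofReal r < r₀ Ω d) {w : H10 Ω} (hw : ‖w‖ ≤ r) (φ : H1 Ω 2) (x : FlowSpace Ω) :
    αΩ Ω d / 2 * ‖x‖ ^ 2 ≤ formA d φ x x + formB d w x x := by
  obtain ⟨hα, hc⟩ := pos_and_c₁_ne_top_of_lt_r₀ h
  have h1 := αΩ_mul_le_formA hα φ x
  have h2 := neg_le_of_abs_le (abs_formB_le hd hc w x x)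
  have h3 : (c₁ Ω).toReal * √(2 + d.κ₃ ^ 2) * ‖w‖ ≤ αΩ Ω d / 2 :=
    (mul_le_mul_of_nonneg_left hw (mul_nonneg ENNReal.toReal_nonneg (Real.sqrt_nonneg _))).trans
      (mul_le_half_αΩ hr h)
  have h4 := mul_le_mul_of_nonneg_right h3 (sq_nonneg (‖x‖))
  nlinarith

/-- If c_gp = ∞ then α̃ = 0, and c₁/α̃ = ∞ because c₁ ≠ 0, against the smallness assumption. -/
theorem cgp_ne_top (hn : 0 < n) (hΩ : IsPolyhedralDomain Ω) {r : ℝ} (hr : 0 < r)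
    (h : ENNReal.ofReal r * (c₁ Ω / αt Ω ΓD d) ≤ 1 / 2) : cgp Ω ΓD ≠ ⊤ := by
  intro hc
  rw [αt, hc, ENNReal.top_pow two_ne_zero, ENNReal.div_top,
    ENNReal.div_zero (c₁_ne_zero hn hΩ), ENNReal.mul_top (ENNReal.ofReal_pos.2 hr).ne'] at h
  exact absurd h (by simp)

theorem norm_le_cgp_mul (hc : cgp Ω ΓD ≠ ⊤) {ψ : H1 Ω 2} (hψ : ψ ∈ H1zero Ω ΓD 2) :
    ‖ψ‖ ≤ (cgp Ω ΓD).toReal * ‖grd ψ‖ := by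
  -- Some admissible constant exists, since the infimum is finite. It handles a field with zero
  -- gradient, which must then vanish.
  have hne : {C : ℝ≥0∞ | ∀ ψ ∈ H1zero Ω ΓD 2,
      ENNReal.ofReal ‖ψ‖ ≤ C * ENNReal.ofReal ‖grd ψ‖}.Nonempty := by
    by_contra hne
    rw [Set.not_nonempty_iff_eq_empty] at hne
    exact hc (by rw [cgp, hne, sInf_empty])
  have h : ENNReal.ofReal ‖ψ‖ ≤ cgp Ω ΓD * ENNReal.ofReal ‖grd ψ‖ := by
    refine le_sInf_mul_of_forall_le (fun C hC => hC ψ hψ) ENNReal.ofReal_ne_top fun h0 => ?_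
    obtain ⟨C, hC⟩ := hne
    have := hC ψ hψ
    rwa [h0, mul_zero, nonpos_iff_eq_zero] at this
  have h2 := ENNReal.toReal_mono (ENNReal.mul_ne_top hc ENNReal.ofReal_ne_top) h
  rwa [ENNReal.toReal_ofReal (norm_nonneg _), ENNReal.toReal_mul,
    ENNReal.toReal_ofReal (norm_nonneg _)] at h2

/-- The first smallness assumption in terms of real numbers. -/
theorem mul_cgp_sq_le (hk : 0 < d.k₀) {r : ℝ} (hr : 0 < r)
    (h : ENNReal.ofReal r * (c₁ Ω / αt Ω ΓD d) ≤ 1 / 2) :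
    r * (c₁ Ω).toReal * (cgp Ω ΓD).toReal ^ 2 ≤ d.k₀ / 2 := by
  have hk' : ENNReal.ofReal d.k₀ ≠ 0 := (ENNReal.ofReal_pos.2 hk).ne'
  rw [αt, ENNReal.div_eq_inv_mul (a := c₁ Ω),
    ENNReal.inv_div (Or.inr ENNReal.ofReal_ne_top) (Or.inr hk')] at h
  have h2 := ENNReal.toReal_mono (by simp) h
  rw [ENNReal.toReal_mul, ENNReal.toReal_mul, ENNReal.toReal_div, ENNReal.toReal_div,
    ENNReal.toReal_pow, ENNReal.toReal_ofReal hr.le, ENNReal.toReal_ofReal hk.le,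
    ENNReal.toReal_one, ENNReal.toReal_ofNat] at h2
  have e : r * ((cgp Ω ΓD).toReal ^ 2 / d.k₀ * (c₁ Ω).toReal) =
      r * (c₁ Ω).toReal * (cgp Ω ΓD).toReal ^ 2 / d.k₀ := by ring
  rw [e, div_le_iff₀ hk] at h2
  linarith

/-- The constant `2 L_ν C_ε C̃_ε (2 + κ₃²)^{1/2}` as a real number. -/
def viscConst (Ω : Set (Vec n)) (d : Data n) (ε : ℝ) : ℝ :=
  (2 * ENNReal.ofReal d.Lν * Cε Ω ε * Cεt Ω ε * root₃ d).toReal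

theorem viscConst_nonneg (ε : ℝ) : 0 ≤ viscConst Ω d ε := ENNReal.toReal_nonneg

/-- Under the second smallness assumption the viscosity constant is finite unless the buoyancy
vanishes. -/
theorem viscConst_ne_top {r ε Chat : ℝ}
    (h : C₁ Ω d r ε Chat * ENNReal.ofReal (‖d.α‖ * ‖d.g‖) ≤ 1 / 2)
    (ha : 0 < ‖d.α‖ * ‖d.g‖) :
    2 * ENNReal.ofReal d.Lν * Cε Ω ε * Cεt Ω ε * root₃ d ≠ ⊤ := by
  intro htop
  have h1 : CST Ω d r ε = ⊤ := by
    rw [CST, htop, max_eq_left (b := max (c₁ Ω * root₃ d) _) le_top, max_eq_right le_top]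
    refine ENNReal.mul_top (mul_ne_zero ?_ ?_)
    · exact (ENNReal.div_pos two_ne_zero ENNReal.ofReal_ne_top).ne'
    · exact (zero_lt_one.trans_le (le_max_left _ _)).ne'
  rw [C₁, h1, ENNReal.top_mul (by simp), ENNReal.top_mul (ENNReal.ofReal_pos.2 ha).ne'] at h
  exact absurd h (by simp)

/-- The second smallness assumption in terms of real numbers. -/
theorem flow_smallness (hα : 0 < αΩ Ω d) (hc : c₁ Ω ≠ ⊤) {r ε Chat : ℝ} (hr : 0 < r)
    (hChat : 0 < Chat) (h : C₁ Ω d r ε Chat * ENNReal.ofReal (‖d.α‖ * ‖d.g‖) ≤ 1 / 2) :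
    2 / αΩ Ω d * (√(2 + d.κ₂ ^ 2) + viscConst Ω d ε * (r * Chat) +
      (c₁ Ω).toReal * √(2 + d.κ₃ ^ 2) * (r * (2 * √2 * √(2 + d.κ₂ ^ 2) / αΩ Ω d))) *
      (‖d.α‖ * ‖d.g‖) ≤ 1 / 2 := by
  -- Without buoyancy the assumption does not make C_ε and C̃_ε finite, but the claim is trivial.
  rcases (mul_nonneg (norm_nonneg d.α) (norm_nonneg d.g)).eq_or_lt with ha | ha
  · rw [← ha, mul_zero]
    norm_num
  have hX := viscConst_ne_top h ha
  have hα' : ENNReal.ofReal (αΩ Ω d) ≠ 0 := (ENNReal.ofReal_pos.2 hα).ne'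
  have hroot : ∀ κ : ℝ, ENNReal.ofReal (√(2 + κ ^ 2)) ≠ ⊤ := fun _ => ENNReal.ofReal_ne_top
  set X := 2 * ENNReal.ofReal d.Lν * Cε Ω ε * Cεt Ω ε * root₃ d
  have hCA : CA Ω d ≠ ⊤ := ENNReal.div_ne_top
    (ENNReal.mul_ne_top (ENNReal.mul_ne_top (by simp) ENNReal.ofReal_ne_top) ENNReal.ofReal_ne_top)
    hα'
  have key : 2 / ENNReal.ofReal (αΩ Ω d) * (root₂ d + X * ENNReal.ofReal (r * Chat) +
      c₁ Ω * root₃ d * (ENNReal.ofReal r * CA Ω d)) * ENNReal.ofReal (‖d.α‖ * ‖d.g‖) ≤ 1 / 2 := by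
    -- Each of the three coefficients is at most the second maximum m in C_ST (1 ≤ √2 for the
    -- first), and the factor max{1, M_r} ≥ 1 can be inserted.
    refine le_trans (mul_le_mul_left ?_ _) h
    rw [C₁, CST]
    set m := max (ENNReal.ofReal (√2) * root₂ d)
      (max X (max (c₁ Ω * root₃ d) (1 + 2 * normAB Ω d r)))
    have h1 : root₂ d ≤ m := by
      refine le_trans ?_ (le_max_left _ _)
      refine le_mul_of_one_le_left' ?_
      rw [ENNReal.one_le_ofReal, Real.one_le_sqrt]
      norm_num
    have h2 : X ≤ m := (le_max_left _ _).trans (le_max_right _ _)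
    have h3 : c₁ Ω * root₃ d ≤ m :=
      (le_max_left _ _).trans ((le_max_right _ _).trans (le_max_right _ _))
    calc 2 / ENNReal.ofReal (αΩ Ω d) * (root₂ d + X * ENNReal.ofReal (r * Chat) +
          c₁ Ω * root₃ d * (ENNReal.ofReal r * CA Ω d))
        ≤ 2 / ENNReal.ofReal (αΩ Ω d) * (m + m * ENNReal.ofReal (r * Chat) +
          m * (ENNReal.ofReal r * CA Ω d)) := by gcongr
      _ = 2 / ENNReal.ofReal (αΩ Ω d) * 1 * m *
          (1 + ENNReal.ofReal (r * Chat) + ENNReal.ofReal r * CA Ω d) := by ring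
      _ ≤ 2 / ENNReal.ofReal (αΩ Ω d) * max 1 (normAB Ω d r) * m *
          (1 + ENNReal.ofReal (r * Chat) + ENNReal.ofReal r * CA Ω d) := by
        gcongr
        exact le_max_left _ _
  have hXr : X.toReal = viscConst Ω d ε := rfl
  clear_value X
  have h2 := ENNReal.toReal_mono (by simp) key
  have f1 : root₂ d ≠ ⊤ := hroot _
  have f2 : X * ENNReal.ofReal (r * Chat) ≠ ⊤ := ENNReal.mul_ne_top hX ENNReal.ofReal_ne_top
  have f3 : c₁ Ω * root₃ d * (ENNReal.ofReal r * CA Ω d) ≠ ⊤ :=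
    ENNReal.mul_ne_top (ENNReal.mul_ne_top hc (hroot _))
      (ENNReal.mul_ne_top ENNReal.ofReal_ne_top hCA)
  rw [ENNReal.toReal_mul, ENNReal.toReal_mul, ENNReal.toReal_add (ENNReal.add_ne_top.2 ⟨f1, f2⟩) f3,
    ENNReal.toReal_add f1 f2] at h2
  simpa only [ENNReal.toReal_mul, CA, root₂, root₃, hXr, ENNReal.toReal_div,
    ENNReal.toReal_ofReal hα.le, ENNReal.toReal_ofReal (Real.sqrt_nonneg _),
    ENNReal.toReal_ofReal hr.le, ENNReal.toReal_ofReal (mul_pos hr hChat).le,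
    ENNReal.toReal_ofReal ha.le, ENNReal.toReal_one, ENNReal.toReal_ofNat] using h2

end Constants

/-! ### The error estimate -/

section Error

variable {n : ℕ} {Ω ΓD : Set (Vec n)} {d : Data n}

theorem le_of_mul_sq_le_mul {a b N : ℝ} (hN : 0 ≤ N) (hb : 0 ≤ b) (h : a * N ^ 2 ≤ b * N) :
    a * N ≤ b := by
  rcases hN.eq_or_lt with h0 | h0
  · rwa [← h0, mul_zero]
  · exact le_of_mul_le_mul_right (by linarith) h0

/-- Test the equation with x itself and use coercivity. The factor √2 is slack, kept to match C_A.
-/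
theorem norm_le_of_solvesFlow (hd : d.Admissible Ω) {r : ℝ} (hr : 0 < r)
    (h : ENNReal.ofReal r < r₀ Ω d) {w : H10 Ω} (hw : ‖w‖ ≤ r) {φ : H1 Ω 2} (hφ : ‖φ‖ ≤ r)
    {x : FlowSpace Ω} (hx : SolvesFlow d w φ x) :
    ‖x‖ ≤ r * (2 * √2 * √(2 + d.κ₂ ^ 2) / αΩ Ω d) * (‖d.α‖ * ‖d.g‖) := by
  have hα := (pos_and_c₁_ne_top_of_lt_r₀ h).1
  have h1 := le_formA_add_formB hd hr h hw φ x
  rw [hx x] at h1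
  have h2 := h1.trans ((le_abs_self _).trans (abs_functF_le hd φ x))
  rw [← mul_assoc] at h2
  have h3 := le_of_mul_sq_le_mul (norm_nonneg_flow x) (by positivity) h2
  have h4 : ‖d.α‖ * ‖d.g‖ * ‖φ‖ * √(2 + d.κ₂ ^ 2) ≤
      √2 * (‖d.α‖ * ‖d.g‖ * r * √(2 + d.κ₂ ^ 2)) := by
    have hs : 1 ≤ √2 := by
      rw [Real.one_le_sqrt]
      norm_num
    refine le_trans ?_ (le_mul_of_one_le_left (by positivity) hs)
    gcongr
  have e : r * (2 * √2 * √(2 + d.κ₂ ^ 2) / αΩ Ω d) * (‖d.α‖ * ‖d.g‖) =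
      (√2 * (‖d.α‖ * ‖d.g‖ * r * √(2 + d.κ₂ ^ 2))) / (αΩ Ω d / 2) := by
    field_simp
  rw [e, le_div_iff₀ (by positivity)]
  linarith

-- The difference of the forms is 2∫(ν(φ) - ν(φ'))t : (r - κ₃τᵈ), with t the strain of x; the
-- regularity assumption bounds ‖t‖_ε by r Ĉ(r)|α||g|.
set_option maxHeartbeats 400000 in
theorem abs_formA_sub_field_le (hd : d.Admissible Ω) {r ε Chat : ℝ}
    (hε0 : 0 < ε) (hεn : 2 * ε < n) (hChat : 0 < Chat) (hreg : FlowRegularity Ω d r ε Chat)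
    (hdata : C₁ Ω d r ε Chat * ENNReal.ofReal (‖d.α‖ * ‖d.g‖) ≤ 1 / 2)
    {w : H10 Ω} {φ : H1 Ω 2} (hball : ‖w‖ + ‖φ‖ ≤ r) {x : FlowSpace Ω} (hx : SolvesFlow d w φ x)
    (φ' : H1 Ω 2) (z : FlowSpace Ω) :
    |formA d φ x z - formA d φ' x z| ≤
      viscConst Ω d ε * (r * Chat) * (‖d.α‖ * ‖d.g‖) * ‖φ - φ'‖ * ‖z‖ := by
  have hw0 : 0 ≤ ‖w‖ := norm_nonneg w
  have hφr : ‖φ‖ ≤ r := by linarith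
  have hr0 : 0 ≤ r := (norm_nonneg φ).trans hφr
  set a := ‖d.α‖ * ‖d.g‖ with ha
  have ha0 : 0 ≤ a := by positivity
  have hfr : fracNorm ε x.t ≤ ENNReal.ofReal (r * Chat * a) := by
    refine (hreg w φ hball x hx).trans (ENNReal.ofReal_le_ofReal ?_)
    have : ‖fld φ‖ ≤ r := (norm_fld_le φ).trans hφr
    calc Chat * ‖d.α‖ * ‖d.g‖ * ‖fld φ‖ ≤ Chat * ‖d.α‖ * ‖d.g‖ * r := by gcongr
      _ = r * Chat * a := by rw [ha]; ring
  have hν := enorm_νSmul_sub_le hd hε0 hεn φ φ' (hfr.trans_lt ENNReal.ofReal_lt_top)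
  set N := ‖νSmul hd φ x.t - νSmul hd φ' x.t‖ with hN
  have key : 2 * ‖νSmul hd φ x.t - νSmul hd φ' x.t‖ₑ * root₃ d ≤
      2 * ENNReal.ofReal d.Lν * Cε Ω ε * Cεt Ω ε * root₃ d *
        (ENNReal.ofReal (r * Chat * a) * ENNReal.ofReal ‖φ - φ'‖) :=
    calc 2 * ‖νSmul hd φ x.t - νSmul hd φ' x.t‖ₑ * root₃ d
        ≤ 2 * (ENNReal.ofReal d.Lν * (Cεt Ω ε * ENNReal.ofReal ‖φ - φ'‖) *
          (Cε Ω ε * ENNReal.ofReal (r * Chat * a))) * root₃ d := by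
          gcongr
          exact hν.trans (by gcongr)
      _ = _ := by ring
  have hreal : 2 * N * √(2 + d.κ₃ ^ 2) ≤ viscConst Ω d ε * (r * Chat * a * ‖φ - φ'‖) := by
    have e1 : (2 * ‖νSmul hd φ x.t - νSmul hd φ' x.t‖ₑ * root₃ d).toReal =
        2 * N * √(2 + d.κ₃ ^ 2) := by
      rw [ENNReal.toReal_mul, ENNReal.toReal_mul, toReal_enorm, root₃,
        ENNReal.toReal_ofReal (Real.sqrt_nonneg _), ENNReal.toReal_ofNat]
    rw [← e1]
    -- If |α||g| = 0, the product of embedding constants may be infinite and `viscConst` a default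
    -- 0; but then ‖t‖_ε = 0 and the left side vanishes.
    rcases ha0.eq_or_lt with h0 | h0
    · rw [← h0, mul_zero, ENNReal.ofReal_zero, zero_mul, mul_zero, nonpos_iff_eq_zero] at key
      rw [key, ENNReal.toReal_zero]
      have := viscConst_nonneg (Ω := Ω) (d := d) ε
      positivity
    · have h1 := ENNReal.toReal_mono (ENNReal.mul_ne_top (viscConst_ne_top hdata h0)
        (ENNReal.mul_ne_top ENNReal.ofReal_ne_top ENNReal.ofReal_ne_top)) key
      refine h1.trans (le_of_eq ?_)
      rw [ENNReal.toReal_mul, ENNReal.toReal_mul (a := ENNReal.ofReal (r * Chat * a)),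
        ENNReal.toReal_ofReal (by positivity), ENNReal.toReal_ofReal (norm_nonneg _)]
      rfl
  rw [formA_sub_field hd, abs_mul, abs_two]
  have h1 := abs_real_inner_le_norm (νSmul hd φ x.t - νSmul hd φ' x.t) (strainTest d z)
  have h2 := norm_strainTest_le d hd.κ₃_nonneg z
  have hN0 : 0 ≤ N := norm_nonneg _
  have h3 := mul_le_mul_of_nonneg_left h2 hN0
  have h4 := mul_le_mul_of_nonneg_right hreal (norm_nonneg_flow z)
  rw [← hN] at h1
  nlinarith only [h1, h3, h4]

theorem le_of_half_mul_sq_le {A K₁ K₂ K₃ b D e Z : ℝ} (hA : 0 < A) (hK₁ : 0 ≤ K₁) (hK₂ : 0 ≤ K₂)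
    (hK₃ : 0 ≤ K₃) (hb : 0 ≤ b) (hD : 0 ≤ D) (he : 0 ≤ e) (hZ : 0 ≤ Z)
    (h : A / 2 * Z ^ 2 ≤ (K₁ * b + K₂ * D + K₃ * e) * Z) :
    Z ≤ 2 / A * K₁ * b + 2 / A * K₂ * D + 2 / A * K₃ * e := by
  have h1 := le_of_mul_sq_le_mul hZ (by positivity) h
  have h2 : Z = 2 / A * (A / 2 * Z) := by field_simp
  rw [h2]
  refine (mul_le_mul_of_nonneg_left h1 (by positivity)).trans (le_of_eq ?_)
  ring

set_option maxHeartbeats 1000000 in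
/-- The Strang-type estimate for the flow unknowns. -/
theorem flow_error_le (hd : d.Admissible Ω) {r ε Chat : ℝ} (hr : 0 < r)
    (hr₀ : ENNReal.ofReal r < r₀ Ω d) (hε0 : 0 < ε) (hεn : 2 * ε < n) (hChat : 0 < Chat)
    (hreg : FlowRegularity Ω d r ε Chat)
    (hdata : C₁ Ω d r ε Chat * ENNReal.ofReal (‖d.α‖ * ‖d.g‖) ≤ 1 / 2) :
    ∃ P Q M : ℝ, 0 ≤ P ∧ 0 ≤ Q ∧ 0 ≤ M ∧ P + Q ≤ 1 / 2 ∧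
      ∀ (x : FlowSpace Ω) (φ : H1 Ω 2), SolvesFlow d x.vel φ x → ‖x.vel‖ + ‖φ‖ ≤ r →
      ∀ (V : Set (FlowSpace Ω)), (∀ y ∈ V, ∀ z ∈ V, y - z ∈ V) →
      ∀ (xh : FlowSpace Ω) (φh : H1 Ω 2), xh ∈ V → ‖xh.vel‖ ≤ r →
      (∀ y ∈ V, formA d φh xh y + formB d xh.vel xh y = functF d φh y) → ∀ y ∈ V,
        ‖xh - y‖ ≤ P * ‖φ - φh‖ + Q * ‖x - xh‖ + M * ‖x - y‖ := by
  obtain ⟨hα, hc⟩ := pos_and_c₁_ne_top_of_lt_r₀ hr₀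
  obtain ⟨M, hM, hA⟩ := exists_abs_formA_le hd
  have hX := viscConst_nonneg (Ω := Ω) (d := d) ε
  have hc0 : 0 ≤ (c₁ Ω).toReal := ENNReal.toReal_nonneg
  have hsmall := flow_smallness hα hc hr hChat hdata
  have hcR : 0 ≤ (c₁ Ω).toReal * √(2 + d.κ₃ ^ 2) := mul_nonneg hc0 (Real.sqrt_nonneg _)
  have hK₁ : 0 ≤ (√(2 + d.κ₂ ^ 2) + viscConst Ω d ε * (r * Chat)) * (‖d.α‖ * ‖d.g‖) := by
    positivity
  have hCA : 0 ≤ r * (2 * √2 * √(2 + d.κ₂ ^ 2) / αΩ Ω d) * (‖d.α‖ * ‖d.g‖) := by positivity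
  have hK₂ : 0 ≤ (c₁ Ω).toReal * √(2 + d.κ₃ ^ 2) *
      (r * (2 * √2 * √(2 + d.κ₂ ^ 2) / αΩ Ω d) * (‖d.α‖ * ‖d.g‖)) := mul_nonneg hcR hCA
  have hK₃ : 0 ≤ M + (c₁ Ω).toReal * √(2 + d.κ₃ ^ 2) * r :=
    add_nonneg hM (mul_nonneg hcR hr.le)
  have hA2 : 0 ≤ 2 / αΩ Ω d := by positivity
  -- P collects the buoyancy and viscosity terms, Q the convective term with its a priori bound of
  -- x, and M the continuity constant of A_{φ_h} + B_{u_h}; each carries the factor 2/α(Ω) from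
  -- coercivity.
  refine ⟨_, _, _, mul_nonneg hA2 hK₁, mul_nonneg hA2 hK₂, mul_nonneg hA2 hK₃, ?_, ?_⟩
  · linarith only [hsmall]
  intro x φ hx hball V hV xh φh hxh hballh hflow y hy
  have hu0 : 0 ≤ ‖x.vel‖ := norm_nonneg x.vel
  have hφ0 : 0 ≤ ‖φ‖ := norm_nonneg φ
  obtain ⟨z, hz⟩ : ∃ z, z = xh - y := ⟨_, rfl⟩
  obtain ⟨e, he⟩ : ∃ e, e = x - y := ⟨_, rfl⟩
  have hzV : z ∈ V := hz ▸ hV _ hxh _ hy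
  have hz0 : 0 ≤ ‖z‖ := norm_nonneg_flow z
  have he0 : 0 ≤ ‖e‖ := norm_nonneg_flow e
  have hd0 : 0 ≤ ‖x - xh‖ := norm_nonneg_flow _
  have hb0 : 0 ≤ ‖φ - φh‖ := norm_nonneg _
  -- The identities `e1` to `e8` make up the Strang decomposition of (A_{φ_h} + B_{u_h})(z, z), and
  -- `b1` to `b5` bound its five terms.
  have h1 := le_formA_add_formB hd hr hr₀ hballh φh z
  have e1 : formA d φh z z = formA d φh xh z - formA d φh y z := by
    conv_lhs => rw [hz]
    rw [formA_sub_left hd, ← hz]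
  have e2 : formB d xh.vel z z = formB d xh.vel xh z - formB d xh.vel y z := by
    conv_lhs => rw [hz]
    rw [formB_sub_left hc, ← hz]
  have e3 := hflow z hzV
  have e4 := hx z
  have e5 : formA d φh e z = formA d φh x z - formA d φh y z := by rw [he, formA_sub_left hd]
  have e6 : formB d xh.vel e z = formB d xh.vel x z - formB d xh.vel y z := by
    rw [he, formB_sub_left hc]
  have e7 := formB_sub_field (d := d) hc x.vel xh.vel x z
  have e8 := functF_sub (d := d) φ φh z
  have b1 := (abs_le.1 (abs_functF_le hd (φ - φh) z)).1
  have b2 := (abs_le.1 (abs_formA_sub_field_le hd hε0 hεn hChat hreg hdata hball hx φh z)).2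
  have b3 := (abs_le.1 (abs_formB_le hd hc (x.vel - xh.vel) x z)).2
  have b4 := (abs_le.1 (hA φh e z)).2
  have b5 := (abs_le.1 (abs_formB_le hd hc xh.vel e z)).2
  have hxn := norm_le_of_solvesFlow hd hr hr₀ (by linarith) (by linarith) hx
  have hvel : ‖x.vel - xh.vel‖ ≤ ‖x - xh‖ := by
    rw [← vel_sub]
    exact norm_vel_le _
  have b3' := mul_le_mul_of_nonneg_right (mul_le_mul (mul_le_mul_of_nonneg_left hvel hcR) hxn
    (norm_nonneg_flow x) (mul_nonneg hcR hd0)) hz0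
  have b5' := mul_le_mul_of_nonneg_right (mul_le_mul_of_nonneg_right
    (mul_le_mul_of_nonneg_left hballh hcR) he0) hz0
  rw [← hz, ← he]
  refine le_of_half_mul_sq_le hα hK₁ hK₂ hK₃ hb0 hd0 he0 hz0 ?_
  linarith only [h1, e1, e2, e3, e4, e5, e6, e7, e8, b1, b2, b3, b4, b5, b3', b5']

/-- From kZ² ≤ kg²G² ≤ g²(crS + MD)Z, cancel Z; the smallness condition rcg² ≤ k/2 turns the
coefficient of S into 1/2. -/
theorem le_of_poincare_sq {k c r g M G Z S D q : ℝ} (hk : 0 < k) (hc : 0 ≤ c) (hr : 0 < r)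
    (hM : 0 ≤ M) (hZ : 0 ≤ Z) (hS : 0 ≤ S) (hD : 0 ≤ D)
    (hsmall : r * c * g ^ 2 ≤ k / 2) (hpoin : Z ≤ g * G) (hlow : k * G ^ 2 ≤ q)
    (hup : q ≤ (c * r * S + M * D) * Z) : Z ≤ S / 2 + g ^ 2 * M / k * D := by
  have p1 : Z ^ 2 ≤ (g * G) ^ 2 := pow_le_pow_left₀ hZ hpoin 2
  have p2 := mul_le_mul_of_nonneg_left (hlow.trans hup) (sq_nonneg g)
  have p3 := mul_le_mul_of_nonneg_left p1 hk.le
  have h1 : k * Z ≤ g ^ 2 * (c * r * S + M * D) :=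
    le_of_mul_sq_le_mul hZ (by positivity) (by linarith)
  have h2 := mul_le_mul_of_nonneg_right hsmall hS
  have e : k * (S / 2 + g ^ 2 * M / k * D) = k / 2 * S + g ^ 2 * M * D := by
    field_simp
  refine le_of_mul_le_mul_left ?_ hk
  rw [e]
  linarith

set_option maxHeartbeats 400000 in
/-- The estimate for the temperature and concentration. -/
theorem transport_error_le (hn : 2 ≤ n) (hΩ : IsPolyhedralDomain Ω) (hd : d.Admissible Ω) {r : ℝ}
    (hr : 0 < r) (hc : c₁ Ω ≠ ⊤) (hdata : ENNReal.ofReal r * (c₁ Ω / αt Ω ΓD d) ≤ 1 / 2) :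
    ∃ N : ℝ, 0 ≤ N ∧ ∀ (u uh : H10 Ω) (φ φh φI : H1 Ω 2), ‖φ‖ ≤ r → ‖uh‖ ≤ r →
      φh - φI ∈ H1zero Ω ΓD 2 → formC d φ (φh - φI) = functG u φ (φh - φI) →
      formC d φh (φh - φI) = functG uh φh (φh - φI) →
        ‖φh - φI‖ ≤ (‖u - uh‖ + ‖φ - φh‖) / 2 + N * ‖φ - φI‖ := by
  have hcgp := cgp_ne_top (by omega) hΩ hr hdata
  have hk := hd.k₀_pos
  have hsmall := mul_cgp_sq_le hk hr hdata
  have hpoin := fun (ψ : H1 Ω 2) (hψ : ψ ∈ H1zero Ω ΓD 2) => norm_le_cgp_mul hcgp hψ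
  obtain ⟨M, hM, hC⟩ := exists_abs_formC_le hd
  have hc0 : 0 ≤ (c₁ Ω).toReal := ENNReal.toReal_nonneg
  have hg0 : 0 ≤ (cgp Ω ΓD).toReal := ENNReal.toReal_nonneg
  refine ⟨(cgp Ω ΓD).toReal ^ 2 * M / d.k₀, by positivity, fun u uh φ φh φI hφ huh hψ h1 h2 => ?_⟩
  have hsub : formC d (φh - φI) (φh - φI) =
      formC d φh (φh - φI) - formC d φI (φh - φI) := formC_sub_left hd _ _ _
  have hsub' : formC d (φ - φI) (φh - φI) =
      formC d φ (φh - φI) - formC d φI (φh - φI) := formC_sub_left hd _ _ _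
  obtain ⟨ψ, hψdef⟩ : ∃ ψ, ψ = φh - φI := ⟨_, rfl⟩
  rw [← hψdef] at h1 h2 hψ hsub hsub' ⊢
  have hψ0 : 0 ≤ ‖ψ‖ := norm_nonneg ψ
  have hb0 : 0 ≤ ‖φ - φh‖ := norm_nonneg _
  have hu0 : 0 ≤ ‖u - uh‖ := norm_nonneg _
  have hD0 : 0 ≤ ‖φ - φI‖ := norm_nonneg _
  -- C(ψ, ψ) = C(φ - φ_I, ψ) - G_{u-u_h, φ}(ψ) - G_{u_h, φ-φ_h}(ψ). With this splitting both
  -- convective terms get the factor c₁r, from ‖φ‖₁ ≤ r and ‖u_h‖₁ ≤ r.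
  have g1 := functG_sub_right hn hc uh φ φh ψ
  have g2 := functG_sub_left hn hc u uh φ ψ
  have b1 := (abs_le.1 (abs_functG_le hn hc uh (φ - φh) ψ)).1
  have b2 := (abs_le.1 (abs_functG_le hn hc (u - uh) φ ψ)).1
  have b3 := (abs_le.1 (hC (φ - φI) ψ)).2
  have b1' := mul_le_mul_of_nonneg_right (mul_le_mul_of_nonneg_right
    (mul_le_mul_of_nonneg_left huh hc0) hb0) hψ0
  have b2' := mul_le_mul_of_nonneg_right (mul_le_mul_of_nonneg_left hφ (mul_nonneg hc0 hu0)) hψ0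
  refine le_of_poincare_sq hk hc0 hr hM hψ0 (add_nonneg hu0 hb0) hD0 hsmall
    (hpoin ψ hψ) (le_formC_self hd ψ) ?_
  linarith only [hsub, hsub', h1, h2, g1, g2, b1, b2, b3, b1', b2']

theorem norm_flow_sub_le (x y z : FlowSpace Ω) : ‖x - y‖ ≤ ‖x - z‖ + ‖y - z‖ := by
  rw [norm_sub_rev y z]
  exact norm_sub_le_norm_sub_add_norm_sub x z y

/-- Combination of the estimates for the flow and for the transport. -/
theorem sum_le_of_coupled {a b e D Y Z P Q M N : ℝ} (hP : 0 ≤ P) (hQ : 0 ≤ Q) (hM : 0 ≤ M) (hN : 0 ≤ N)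
    (ha : 0 ≤ a) (he : 0 ≤ e) (hD : 0 ≤ D) (hPQ : P + Q ≤ 1 / 2)
    (h1 : a ≤ e + Z) (hZ : Z ≤ P * b + Q * a + M * e) (h2 : b ≤ D + Y)
    (hY : Y ≤ (a + b) / 2 + N * D) :
    a + b ≤ (4 * (1 + M) + 6 * (1 + N)) * (e + D) := by
  -- First absorb b/2. Inserting this into the flow estimate gives a ≤ (1+M)e + (P+Q)a + 2P(1+N)D,
  -- hence a ≤ 2(1+M)e + 2(1+N)D and b ≤ 2(1+M)e + 4(1+N)D.
  have hb : b ≤ a + 2 * ((1 + N) * D) := by linarith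
  have hPb := mul_le_mul_of_nonneg_left hb hP
  have hPQa := mul_le_mul_of_nonneg_right hPQ ha
  have hND : 0 ≤ (1 + N) * D := by positivity
  have hMe : 0 ≤ (1 + M) * e := by positivity
  have hPD := mul_le_mul_of_nonneg_right (by linarith : P ≤ 1 / 2) hND
  have hMD : 0 ≤ (1 + M) * D := by positivity
  have hNe : 0 ≤ (1 + N) * e := by positivity
  linarith

end Error

end

end DoubleDiffusion

/-! ### Quasi-optimality of the Galerkin scheme -/

set_option maxHeartbeats 1000000 in
open DoubleDiffusion in
theorem mainTheorem3 {n : ℕ} (hn : n = 2 ∨ n = 3)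
    (Ω ΓD ΓN : Set (Vec n)) (hΩ : IsPolyhedralDomain Ω) (hΓ : IsBoundarySplit Ω ΓD ΓN)
    (d : Data n) (hd : d.Admissible Ω)
    (φD : Vec n → Vec 2) (E : H1 Ω 2) (hE : IsMinExtension ΓD φD E)
    (k : ℕ)
    (r : ℝ) (hr : 0 < r) (hr₀ : ENNReal.ofReal r < r₀ Ω d)
    (ε : ℝ) (hε0 : 0 < ε) (hε1 : ε < 1) (hε3 : n = 3 → 1 / 2 ≤ ε)
    (Chat : ℝ) (hChat : 0 < Chat) (hreg : FlowRegularity Ω d r ε Chat)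
    (hdata1 : ENNReal.ofReal r * (c₁ Ω / αt Ω ΓD d) ≤ 1 / 2)
    (hdata2 : C₁ Ω d r ε Chat * ENNReal.ofReal (‖d.α‖ * ‖d.g‖) ≤ 1 / 2) :
    ∃ Cstar : ℝ, 0 < Cstar ∧
      ∀ (x : FlowSpace Ω) (φ : H1 Ω 2), IsSolution d ΓD φD r x φ →
      ∀ T : Geometry.SimplicialComplex ℝ (Vec n), IsMesh Ω ΓD T →
      ∀ I : H1 Ω 2 → H1 Ω 2, IsScottZhang Ω ΓD T k I →
      ∀ (xh : FlowSpace Ω) (φh : H1 Ω 2), IsDiscreteSolution Ω ΓD T k d I E r xh φh →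
        ‖x - xh‖ + ‖φ - φh‖ ≤
          Cstar * (Metric.infDist x (flowFE Ω T k) + ‖φ - I φ‖) := by
  have hn2 : 2 ≤ n := by omega
  have hεn : 2 * ε < n := by
    rcases hn with rfl | rfl <;> push_cast <;> linarith
  have hc := (pos_and_c₁_ne_top_of_lt_r₀ hr₀).2
  obtain ⟨P, Q, M, hP, hQ, hM, hPQ, hflow⟩ :=
    flow_error_le hd hr hr₀ hε0 hεn hChat hreg hdata2
  obtain ⟨N, hN, htrans⟩ := transport_error_le hn2 hΩ hd hr hc hdata1
  have hC : 0 < 4 * (1 + M) + 6 * (1 + N) := by positivity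
  refine ⟨4 * (1 + M) + 6 * (1 + N), hC, fun x φ hx T hT I hI xh φh hxh => ?_⟩
  have hu0 : 0 ≤ ‖x.vel‖ := norm_nonneg x.vel
  have huh0 : 0 ≤ ‖xh.vel‖ := norm_nonneg xh.vel
  have hφ0 : 0 ≤ ‖φ‖ := norm_nonneg φ
  have hφh0 : 0 ≤ ‖φh‖ := norm_nonneg φh
  have hball := hx.ball
  have hballh := hxh.ball
  -- Subtract Iφ - IE from φ_h - IE: both vanish on Γ_D, the former because φ and E share the trace
  -- φ_D.
  have hψ : φh - I φ ∈ lagrangeDir Ω ΓD T k := by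
    have h := lagrangeDir_sub hxh.dirichlet (hI.sub_mem_lagrangeDir hΩ hΓ hT hx.dirichlet hE.1)
    have e : φh - I E - (I φ - I E) = φh - I φ := by abel
    rwa [e] at h
  have hψ0 := lagrangeDir_subset_H1zero hψ
  have hY := htrans x.vel xh.vel φ φh (I φ) (by linarith) (by linarith) hψ0
    (hx.transport _ hψ0) (hxh.transport _ hψ)
  have hvel : ‖x.vel - xh.vel‖ ≤ ‖x - xh‖ := by
    rw [← vel_sub]
    exact norm_vel_le _
  have hb : ‖φ - φh‖ ≤ ‖φ - I φ‖ + ‖φh - I φ‖ := by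
    rw [norm_sub_rev φh (I φ)]
    exact norm_sub_le_norm_sub_add_norm_sub φ (I φ) φh
  -- Isolating the distance reduces the claim to each discrete y separately; x_h witnesses that the
  -- space is nonempty.
  rw [← div_le_iff₀' hC, ← sub_le_iff_le_add,
    Metric.le_infDist (⟨xh, hxh.mem_flow⟩ : (flowFE Ω T k).Nonempty)]
  intro y hy
  rw [dist_eq_norm, sub_le_iff_le_add, div_le_iff₀' hC]
  have hZ := hflow x φ hx.flow hball (flowFE Ω T k) (fun _ h _ h' => flowFE_sub h h') xh φh
    hxh.mem_flow (by linarith) hxh.flow y hy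
  exact sum_le_of_coupled hP hQ hM hN (norm_nonneg_flow _) (norm_nonneg_flow _) (norm_nonneg _)
    hPQ (norm_flow_sub_le x xh y) hZ hb (hY.trans (by linarith))
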